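/- **Setting.** Let $(X_j,Y_j,S_j)_{j\in\mathbb Z}$ be random variables on a probability space with $X_j\in\{0,1\}$, $Y_j\in\mathcal Y$, $S_j\in\mathcal S$, where $\mathcal Y,\mathcal S$ are finite sets. The process is a *finite-state aperiodic irreducible Markov (FAIM) process* if it is strictly stationary; for every $j$, conditionally on $S_{j-1}$, the family $(X_k,Y_k,S_k)_{k\ge j}$ is independent of the family $(X_l,Y_l,S_{l-1})_{l<j}$; and the (homogeneous, stationary) Markov chain $(S_j)$ on $\mathcal S$ is irreducible and aperiodic. For random variables $U,Q$ with finite alphabets let $H(U|Q)=-\sum_{q,u}p_{U,Q}(u,q)\log_2\frac{p_{U,Q}(u,q)}{\sum_{u'}p_{U,Q}(u',q)}$. For $N=2^n$ let $G_N=B_N\begin{bmatrix}1&0\\1&1\end{bmatrix}^{\otimes n}$ over $\mathbb F_2$, with $B_N$ the $N\times N$ bit-reversal matrix, and put $$U_1^N=X_1^N G_N,\qquad Q_i=(U_1^{i-1},Y_1^N)\quad(1\le i\le N).$$ Let $B_1,B_2,\dots$ be i.i.d. Bernoulli-$1/2$ random variables and, for each $n$, let $i$ be the random index with $i-1=\sum_{j=1}^nB_j2^{n-j}$.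 Define the conditional entropy process and its boundary-state-informed (BSI) version by $$H_n=H(U_i\,|\,Q_i),\qquad \hat H_n=H(U_i\,|\,Q_i,S_N,S_0),$$ where the entropies are the deterministic numbers determined by the index $i$. A sequence of $[0,1]$-valued random variables *polarizes* to $A_\infty$ if it converges almost surely to $A_\infty$ and $A_\infty$ is $\{0,1\}$-valued. **Theorem.** Let $(X_j,Y_j,S_j)_{j\in\mathbb Z}$ be a FAIM process. Then: 1. The limit $H_\star(X|Y)=\lim_{N\to\infty}\frac1N H(X_1^N|Y_1^N)$ exists. 2. $\hat H_n$ takes values in $[0,1]$ and is a submartingale, both with respect to the filtration $\sigma(B_1,\dots,B_n)$ and with respect to its own natural filtration. 3. $H_n$ polarizes to a random variable $H_\infty$ with $\Pr(H_\infty=1)=H_\star(X|Y)$, $\hat H_n$ polarizes to a random variable $\hat H_\infty$, and $\hat H_\infty=H_\infty$ almost surely. 4. In particular, for every $0<\epsilon<1$, as $n\to\infty$ with $N=2^n$, $$\lim_{N\to\infty}\frac1N\bigl|\{i: H(U_i|Q_i,S_0,S_N)>1-\epsilon\}\bigr|=H_\star(X|Y),\qquad \lim_{N\to\infty}\frac1N\bigl|\{i: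 H(U_i|Q_i,S_0,S_N)<\epsilon\}\bigr|=1-H_\star(X|Y).$$ -/

import Mathlib

open MeasureTheory ProbabilityTheory Filter Topology
open scoped ENNReal Kronecker

noncomputable section

namespace FAIM

/-! ## Conditional entropy -/

section Entropy

variable {Ω α β : Type*} [MeasurableSpace Ω] [Fintype α] [Fintype β]

/-- Conditional entropy, in bits, of `U` given `Q`, for random variables with finite alphabets:
`H(U|Q) = - ∑_q ∑_u p(u,q) log₂ (p(u,q) / ∑_u' p(u',q))`. -/
def condEntropy (P : Measure Ω) (U : Ω → α) (Q : Ω → β) : ℝ :=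
  -∑ q : β, ∑ u : α, P.real {ω | U ω = u ∧ Q ω = q} *
    Real.logb 2 (P.real {ω | U ω = u ∧ Q ω = q} / ∑ u' : α, P.real {ω | U ω = u' ∧ Q ω = q})

end Entropy

/-! ## Finite-state aperiodic irreducible Markov processes -/

section Processes

variable {Ω 𝒴 𝒮 : Type*} [MeasurableSpace Ω]

/-- The `n`-step transition probability `π_{n|0}(b|a) = P(S_n = b | S_0 = a)`. -/
def transProb (P : Measure Ω) (S : ℤ → Ω → 𝒮) (n : ℕ) (a b : 𝒮) : ℝ :=
  P.real {ω | S 0 ω = a ∧ S n ω = b} / P.real {ω | S 0 ω = a}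

/-- `(X_j, Y_j, S_j)`, `j ∈ ℤ`, is a finite-state aperiodic irreducible Markov (FAIM) process
with binary `X_j`, on the probability space `(Ω, P)`. -/
structure IsFAIM (P : Measure Ω) (X : ℤ → Ω → ZMod 2) (Y : ℤ → Ω → 𝒴) (S : ℤ → Ω → 𝒮) :
    Prop where
  /-- `X_j`, `Y_j`, `S_j` are random variables (with values in finite alphabets). -/
  measurable_X : ∀ j x, MeasurableSet {ω | X j ω = x}
  measurable_Y : ∀ j y, MeasurableSet {ω | Y j ω = y}
  measurable_S : ∀ j s, MeasurableSet {ω | S j ω = s}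
  /-- Strict stationarity: the finite-dimensional distributions are shift invariant. -/
  stationary : ∀ (k : ℤ) (I : Finset ℤ) (z : ℤ → ZMod 2 × 𝒴 × 𝒮),
    P {ω | ∀ j ∈ I, (X (j + k) ω, Y (j + k) ω, S (j + k) ω) = z j} =
      P {ω | ∀ j ∈ I, (X j ω, Y j ω, S j ω) = z j}
  /-- Markov property: conditionally on `S_{j-1}`, the family `(X_k, Y_k, S_k)`, `k ≥ j`, is
  independent of the family `(X_l, Y_l, S_{l-1})`, `l < j`. Here
  `P(F ∩ G | S_{j-1} = s) = P(F | S_{j-1} = s) P(G | S_{j-1} = s)` is required for all cylinder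
  events `F` of the first and `G` of the second family, with denominators cleared. -/
  markov : ∀ (j : ℤ) (s : 𝒮) (I J : Finset ℤ), (∀ k ∈ I, j ≤ k) → (∀ l ∈ J, l < j) →
    ∀ z w : ℤ → ZMod 2 × 𝒴 × 𝒮,
      P {ω | S (j - 1) ω = s} *
        P {ω | S (j - 1) ω = s ∧ (∀ k ∈ I, (X k ω, Y k ω, S k ω) = z k) ∧
            (∀ l ∈ J, (X l ω, Y l ω, S (l - 1) ω) = w l)} =
      P {ω | S (j - 1) ω = s ∧ (∀ k ∈ I, (X k ω, Y k ω, S k ω) = z k)} *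
        P {ω | S (j - 1) ω = s ∧ (∀ l ∈ J, (X l ω, Y l ω, S (l - 1) ω) = w l)}
  /-- The state chain is irreducible. -/
  irreducible : ∀ a b : 𝒮, ∃ n : ℕ, 1 ≤ n ∧ 0 < transProb P S n a b
  /-- The state chain is aperiodic: the return times of every state have greatest common
  divisor `1`. -/
  aperiodic : ∀ a : 𝒮, Nat.setGcd {n : ℕ | 1 ≤ n ∧ 0 < transProb P S n a a} = 1

/-- The block `X_1^N`, as a row vector indexed by `0, …, N-1` (entry `j` is `X_{j+1}`). -/
def block {α : Type*} (X : ℤ → Ω → α) (N : ℕ) (ω : Ω) : Fin N → α :=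
  fun j => X ((j : ℤ) + 1) ω

/-- The entropy rate `H⋆(X|Y) = lim_{N → ∞} H(X_1^N | Y_1^N) / N`. -/
def condEntropyRate [Fintype 𝒴] (P : Measure Ω) (X : ℤ → Ω → ZMod 2) (Y : ℤ → Ω → 𝒴) : ℝ :=
  limUnder atTop (fun N : ℕ => condEntropy P (block X N) (block Y N) / (N : ℝ))

end Processes

/-! ## The polarization transform -/

/-- The kernel `G₂`, with rows `(1, 0)` and `(1, 1)`. -/
def G₂ : Matrix (Fin 2) (Fin 2) (ZMod 2) := !![1, 0; 1, 1]

/-- The Kronecker power `G₂^{⊗n}`, as a matrix of size `2 ^ n`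
(rows and columns are in the usual order of the Kronecker product). -/
def kronPow : (n : ℕ) → Matrix (Fin (2 ^ n)) (Fin (2 ^ n)) (ZMod 2)
  | 0 => 1
  | n + 1 => Matrix.reindex finProdFinEquiv finProdFinEquiv (kronPow n ⊗ₖ G₂)

/-- The bit-reversal permutation of `{0, …, 2 ^ n - 1}`. (`finFunctionFinEquiv` sends `f` to the
number `∑ i, f i * 2 ^ i`.) -/
def bitRev (n : ℕ) : Equiv.Perm (Fin (2 ^ n)) :=
  finFunctionFinEquiv.symm.trans
    ((Equiv.arrowCongr (Fin.revPerm : Equiv.Perm (Fin n)) (Equiv.refl (Fin 2))).trans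
      finFunctionFinEquiv)

/-- Arıkan's matrix `G_N = B_N G₂^{⊗n}`, `N = 2 ^ n`, with `B_N` the bit-reversal matrix. -/
def polarMatrix (n : ℕ) : Matrix (Fin (2 ^ n)) (Fin (2 ^ n)) (ZMod 2) :=
  (bitRev n).permMatrix (ZMod 2) * kronPow n

section Polar

variable {Ω 𝒴 𝒮 : Type*}

/-- `U_1^N = X_1^N G_N`, `N = 2 ^ n`. The index is `i - 1 ∈ {0, …, N - 1}`. -/
def polarU (X : ℤ → Ω → ZMod 2) (n : ℕ) (i : Fin (2 ^ n)) (ω : Ω) : ZMod 2 :=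
  Matrix.vecMul (block X (2 ^ n) ω) (polarMatrix n) i

/-- `Q_i = (U_1^{i-1}, Y_1^N)`, `N = 2 ^ n`. -/
def polarQ (X : ℤ → Ω → ZMod 2) (Y : ℤ → Ω → 𝒴) (n : ℕ) (i : Fin (2 ^ n)) (ω : Ω) :
    ({k : Fin (2 ^ n) // k < i} → ZMod 2) × (Fin (2 ^ n) → 𝒴) :=
  (fun k => polarU X n k ω, block Y (2 ^ n) ω)

variable [MeasurableSpace Ω] [Fintype 𝒴] [Fintype 𝒮]

/-- `H(U_i | Q_i)`. -/
def indexEntropy (P : Measure Ω) (X : ℤ → Ω → ZMod 2) (Y : ℤ → Ω → 𝒴) (n : ℕ)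
    (i : Fin (2 ^ n)) : ℝ :=
  condEntropy P (polarU X n i) (polarQ X Y n i)

/-- The boundary-state-informed conditional entropy `H(U_i | Q_i, S_N, S_0)`, `N = 2 ^ n`. -/
def bsiIndexEntropy (P : Measure Ω) (X : ℤ → Ω → ZMod 2) (Y : ℤ → Ω → 𝒴) (S : ℤ → Ω → 𝒮)
    (n : ℕ) (i : Fin (2 ^ n)) : ℝ :=
  condEntropy P (polarU X n i) (fun ω => (polarQ X Y n i ω, S ((2 ^ n : ℕ) : ℤ) ω, S 0 ω))

end Polar

/-! ## The random index and the entropy processes -/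

section RandomIndex

variable {Ω' : Type*}

/-- `i - 1 = (B_1 B_2 ⋯ B_n)₂ = ∑_{j=1}^n B_j 2^{n-j}`. The bit `B_{j+1}` is `B j`. -/
def bitIndex (B : ℕ → Ω' → Fin 2) (n : ℕ) (ω : Ω') : Fin (2 ^ n) :=
  finFunctionFinEquiv (fun j : Fin n => B (j.rev : ℕ) ω)

/-- The bits are independent and uniformly distributed. -/
structure IsFairBits [MeasurableSpace Ω'] (μ : Measure Ω') (B : ℕ → Ω' → Fin 2) : Prop where
  measurable : ∀ j, Measurable (B j)
  indep : iIndepFun B μ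
  uniform : ∀ j b, μ {ω | B j ω = b} = 1 / 2

/-- The filtration `ℱ_n = σ(B_1, …, B_n)`. -/
def bitFiltration [m : MeasurableSpace Ω'] (B : ℕ → Ω' → Fin 2) (hB : ∀ j, Measurable (B j)) :
    Filtration ℕ m where
  seq n := ⨆ j < n, MeasurableSpace.comap (B j) inferInstance
  mono' _ _ hij := biSup_mono fun _ hk => lt_of_lt_of_le hk hij
  le' _ := iSup₂_le fun j _ => (hB j).comap_le

variable {Ω 𝒴 𝒮 : Type*} [MeasurableSpace Ω] [Fintype 𝒴] [Fintype 𝒮]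

/-- The conditional entropy process `H_n`. -/
def entropyProc (P : Measure Ω) (X : ℤ → Ω → ZMod 2) (Y : ℤ → Ω → 𝒴) (B : ℕ → Ω' → Fin 2)
    (n : ℕ) (ω : Ω') : ℝ :=
  indexEntropy P X Y n (bitIndex B n ω)

/-- The boundary-state-informed conditional entropy process `Ĥ_n`. -/
def bsiEntropyProc (P : Measure Ω) (X : ℤ → Ω → ZMod 2) (Y : ℤ → Ω → 𝒴) (S : ℤ → Ω → 𝒮)
    (B : ℕ → Ω' → Fin 2) (n : ℕ) (ω : Ω') : ℝ :=
  bsiIndexEntropy P X Y S n (bitIndex B n ω)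

/-- `A_n` polarizes to `A_∞`: the `A_n` are random variables with values in `[0,1]` that converge
almost surely to the `{0,1}`-valued random variable `A_∞`. -/
structure PolarizesTo [MeasurableSpace Ω'] (μ : Measure Ω') (A : ℕ → Ω' → ℝ) (Ainf : Ω' → ℝ) :
    Prop where
  measurable : ∀ n, Measurable (A n)
  mem_Icc : ∀ n ω, A n ω ∈ Set.Icc (0 : ℝ) 1
  measurable_lim : Measurable Ainf
  lim_eq : ∀ ω, Ainf ω = 0 ∨ Ainf ω = 1
  tendsto : ∀ᵐ ω ∂μ, Tendsto (fun n => A n ω) atTop (𝓝 (Ainf ω))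

end RandomIndex

end FAIM

end

noncomputable section

namespace FAIM

/-! ## Shannon entropy of finitely valued random variables -/

section Shannon

/-! Given the state between two consecutive blocks, the blocks are conditionally independent. With
the boundary states in the conditioning, the chain rule over two halves, the Markov property at the
midpoint and the fact that revealing the middle state lowers entropy give
`two_mul_bsiIndexEntropy_le`: the two children of an index have on average at least its own entropy.
So Ĥ_n is a submartingale with values in [0,1] and converges almost surely.

The boundary states cost little. Summed over all `2 ^ n` indices, the nonnegative gaps between
H(U_i|Q_i) and its boundary-informed version total at most the entropy of one pair of states
(`sum_sub_le`). The mean of H_n - Ĥ_n is therefore O(2^{-n}), which is summable, and the two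
processes have the same limit almost surely.

The limit is 0 or 1 because of a strict gain. Adjacent blocks share a state, so the mixing bound
does not apply to their conditioning data. After two minus steps, however, the bit is a sum of four;
revealing the two middle bits and the boundary states leaves the sum of the two outer bits
(`ent_outer_le`), whose inner states are 2N apart. The state chain is primitive, so the joint law of
distant states dominates a fixed multiple of the product of the marginals (`exists_mixing`). Binary
convolution (`condEntropy_add_ge`) then yields `exists_gain`: at the minus-minus grandchild, H_{n+2}
exceeds Ĥ_n by at least c(1 - Ĥ_n)Ĥ_n². Averaging bounds the mean of (1 - Ĥ_n)Ĥ_n² by a multiple of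
the mean of |H_{n+2} - Ĥ_n|, which tends to 0.

The transform is invertible, so the average of H(U_i|Q_i) is H(X_1^N|Y_1^N)/N, which converges by
Fekete's lemma. Bounded convergence identifies its limit with the mean of the polarized limit, and
the same principle applied to indicators gives the index counts. -/

theorem exists_eq_comp {Ω α β : Type*} [hΩ : Nonempty Ω] {f : Ω → α} {g : Ω → β}
    (h : ∀ ω ω', f ω = f ω' → g ω = g ω') : ∃ e : α → β, g = fun ω => e (f ω) := by
  have : Nonempty β := hΩ.map g
  obtain ⟨e, he⟩ := (Function.factorsThrough_iff g).1 (fun ω ω' => h ω ω')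
  exact ⟨e, he⟩

theorem sum_rotate {α β γ : Type*} [Fintype α] [Fintype β] [Fintype γ] (F : α → β → γ → ℝ) :
    ∑ a, ∑ b, ∑ c, F a b c = ∑ c, ∑ a, ∑ b, F a b c := by
  rw [Finset.sum_comm (s := (Finset.univ : Finset γ))]
  exact Finset.sum_congr rfl fun a _ => Finset.sum_comm

variable {Ω α β γ : Type*} [MeasurableSpace Ω]

/-- All preimages under `f` are measurable: `f` is a random variable with discrete alphabet. -/
def Discr (f : Ω → α) : Prop := ∀ s : Set α, MeasurableSet (f ⁻¹' s)

/-- The probability mass function of `f`. -/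
def law (P : Measure Ω) (f : Ω → α) (a : α) : ℝ := P.real (f ⁻¹' {a})

/-- The entropy of `f`, in nats. -/
def ent [Fintype α] (P : Measure Ω) (f : Ω → α) : ℝ := ∑ a, Real.negMulLog (law P f a)

theorem discr_of_singleton [Finite α] {f : Ω → α} (h : ∀ a, MeasurableSet {ω | f ω = a}) :
    Discr f := fun s => by
  have : f ⁻¹' s = ⋃ a ∈ s, {ω | f ω = a} := by ext; simp
  rw [this]
  exact MeasurableSet.biUnion s.to_countable fun a _ => h a

theorem Discr.comp {f : Ω → α} (hf : Discr f) (e : α → β) : Discr (fun ω => e (f ω)) :=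
  fun s => hf (e ⁻¹' s)

theorem Discr.prodMk [Finite α] [Finite β] {f : Ω → α} {g : Ω → β} (hf : Discr f)
    (hg : Discr g) : Discr (fun ω => (f ω, g ω)) := discr_of_singleton fun a => by
  have : {ω | (f ω, g ω) = a} = f ⁻¹' {a.1} ∩ g ⁻¹' {a.2} := by
    ext; simp [Prod.ext_iff]
  rw [this]
  exact (hf _).inter (hg _)

theorem Discr.pi {ι : Type*} [Finite ι] [Finite α] {f : ι → Ω → α} (hf : ∀ i, Discr (f i)) :
    Discr (fun ω i => f i ω) := discr_of_singleton fun a => by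
  have : {ω | (fun i => f i ω) = a} = ⋂ i, f i ⁻¹' {a i} := by
    ext; simp [funext_iff]
  rw [this]
  exact MeasurableSet.iInter fun i => hf i _

variable (P : Measure Ω)

theorem law_nonneg (f : Ω → α) (a : α) : 0 ≤ law P f a := measureReal_nonneg

theorem law_le_one [IsProbabilityMeasure P] (f : Ω → α) (a : α) : law P f a ≤ 1 :=
  measureReal_le_one

variable {P}

theorem measureReal_preimage_eq_sum [Fintype α] [IsFiniteMeasure P] {f : Ω → α} (hf : Discr f)
    (s : Set α) [DecidablePred (· ∈ s)] :
    P.real (f ⁻¹' s) = ∑ a, if a ∈ s then law P f a else 0 := by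
  rw [← Finset.sum_filter]
  have := sum_measureReal_preimage_singleton (μ := P) (Finset.univ.filter (· ∈ s)) (f := f)
    (fun y _ => hf {y})
  simp only [law]
  rw [this]
  simp

theorem law_comp [Fintype α] [DecidableEq β] [IsFiniteMeasure P] {f : Ω → α} (hf : Discr f)
    (e : α → β) (b : β) :
    law P (fun ω => e (f ω)) b = ∑ a, if e a = b then law P f a else 0 := by
  let _ : DecidablePred (· ∈ e ⁻¹' {b}) := fun a => inferInstanceAs (Decidable (e a = b))
  exact measureReal_preimage_eq_sum (P := P) hf (e ⁻¹' {b})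

theorem sum_law [Fintype α] [IsProbabilityMeasure P] {f : Ω → α} (hf : Discr f) :
    ∑ a, law P f a = 1 := by
  classical
  have := measureReal_preimage_eq_sum (P := P) hf Set.univ
  simpa using this.symm

theorem law_fst [Fintype α] [Fintype β] [IsFiniteMeasure P] {f : Ω → α} {g : Ω → β}
    (h : Discr (fun ω => (f ω, g ω))) (a : α) :
    law P f a = ∑ b, law P (fun ω => (f ω, g ω)) (a, b) := by
  classical
  have := law_comp (P := P) h Prod.fst a
  simp only at this
  rw [this, Fintype.sum_prod_type, Finset.sum_comm]
  simp

theorem law_snd [Fintype α] [Fintype β] [IsFiniteMeasure P] {f : Ω → α} {g : Ω → β}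
    (h : Discr (fun ω => (f ω, g ω))) (b : β) :
    law P g b = ∑ a, law P (fun ω => (f ω, g ω)) (a, b) := by
  classical
  have := law_comp (P := P) h Prod.snd b
  simp only at this
  rw [this, Fintype.sum_prod_type]
  simp

/-! ### Elementary inequalities for entropy -/

theorem ent_comp_le [Fintype α] [Fintype β] [IsFiniteMeasure P] {f : Ω → α} (hf : Discr f)
    (e : α → β) : ent P (fun ω => e (f ω)) ≤ ent P f := by
  classical
  have key : ∀ b, Real.negMulLog (law P (fun ω => e (f ω)) b) ≤
      ∑ a, if e a = b then Real.negMulLog (law P f a) else 0 := by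
    intro b
    conv_lhs => rw [Real.negMulLog, neg_mul, ← mul_neg]
    nth_rewrite 1 [law_comp hf]
    rw [Finset.sum_mul]
    refine Finset.sum_le_sum fun a _ => ?_
    split_ifs with hab
    · rcases (law_nonneg P f a).eq_or_lt with h0 | h0
      · simp [← h0]
      -- An atom has at most the mass of its fibre, so the logarithm may be taken at the fibre.
      · have hle : law P f a ≤ law P (fun ω => e (f ω)) b :=
          measureReal_mono (fun ω hω => by
            simp only [Set.mem_preimage, Set.mem_singleton_iff] at hω ⊢; rw [hω, hab])
        have := Real.log_le_log h0 hle
        rw [Real.negMulLog]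
        nlinarith
    · simp
  refine (Finset.sum_le_sum fun b _ => key b).trans ?_
  rw [Finset.sum_comm]
  simp [ent]

theorem ent_mono [Fintype α] [Fintype β] [IsProbabilityMeasure P] {f : Ω → α} (hf : Discr f)
    {g : Ω → β} (h : ∀ ω ω', f ω = f ω' → g ω = g ω') : ent P g ≤ ent P f := by
  have := P.nonempty_of_neZero
  obtain ⟨e, rfl⟩ := exists_eq_comp h
  exact ent_comp_le hf e

/-- Entropy depends only on the partition that a variable generates. This is the tool for reordering
tuples, dropping redundant components and exchanging variables whose alphabets have different types.
-/
theorem ent_congr [Fintype α] [Fintype β] [IsProbabilityMeasure P] {f : Ω → α} (hf : Discr f)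
    {g : Ω → β} (h : ∀ ω ω', f ω = f ω' ↔ g ω = g ω') : ent P f = ent P g := by
  refine le_antisymm (ent_mono ?_ fun ω ω' => (h ω ω').2) (ent_mono hf fun ω ω' => (h ω ω').1)
  have := P.nonempty_of_neZero
  obtain ⟨e, rfl⟩ := exists_eq_comp fun ω ω' => (h ω ω').1
  exact hf.comp e

theorem ent_nonneg [Fintype α] [IsProbabilityMeasure P] (f : Ω → α) : 0 ≤ ent P f :=
  Finset.sum_nonneg fun a _ => Real.negMulLog_nonneg (law_nonneg P f a) (law_le_one P f a)

theorem ent_le_log_card [Fintype α] [IsProbabilityMeasure P] {f : Ω → α} (hf : Discr f) :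
    ent P f ≤ Real.log (Fintype.card α) := by
  have hne : Nonempty α := P.nonempty_of_neZero.map f
  have hm : (0 : ℝ) < Fintype.card α := by exact_mod_cast Fintype.card_pos
  have key : ∀ a, Real.negMulLog (law P f a) - law P f a * Real.log (Fintype.card α) ≤
      1 / Fintype.card α - law P f a := by
    intro a
    rcases (law_nonneg P f a).eq_or_lt with h0 | h0
    · rw [← h0]; simp
    · have := Real.log_le_sub_one_of_pos (x := 1 / (law P f a * Fintype.card α)) (by positivity)
      rw [one_div, Real.log_inv, Real.log_mul h0.ne' hm.ne'] at this
      have h2 := mul_le_mul_of_nonneg_left this h0.le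
      rw [Real.negMulLog]
      have h3 : law P f a * ((law P f a * Fintype.card α)⁻¹ - 1) =
          1 / Fintype.card α - law P f a := by field_simp
      linarith
  have := Finset.sum_le_sum fun a (_ : a ∈ Finset.univ) => key a
  rw [Finset.sum_sub_distrib, Finset.sum_sub_distrib, ← Finset.sum_mul, sum_law hf] at this
  simp only [Finset.sum_const, Finset.card_univ, nsmul_eq_mul] at this
  rw [mul_one_div_cancel hm.ne'] at this
  rw [ent]
  linarith

/-- The mutual information is the expectation of the logarithm of a density. -/
theorem mutualInfo_eq_sum [Fintype α] [Fintype β] [Fintype γ] [IsProbabilityMeasure P]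
    {f : Ω → α} {g : Ω → β} {k : Ω → γ} (hf : Discr f) (hg : Discr g) (hk : Discr k) :
    ent P (fun ω => (f ω, k ω)) + ent P (fun ω => (g ω, k ω)) -
      ent P (fun ω => (f ω, g ω, k ω)) - ent P k =
    ∑ a, ∑ b, ∑ c, law P (fun ω => (f ω, g ω, k ω)) (a, b, c) *
      (Real.log (law P (fun ω => (f ω, g ω, k ω)) (a, b, c)) + Real.log (law P k c) -
        Real.log (law P (fun ω => (f ω, k ω)) (a, c)) -
        Real.log (law P (fun ω => (g ω, k ω)) (b, c))) := by
  classical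
  have hall := hf.prodMk (hg.prodMk hk)
  have h1 : ∀ a c, law P (fun ω => (f ω, k ω)) (a, c) =
      ∑ b, law P (fun ω => (f ω, g ω, k ω)) (a, b, c) := by
    intro a c
    have := law_comp (P := P) hall (fun x => (x.1, x.2.2)) (a, c)
    simp only at this
    rw [this, Fintype.sum_prod_type]
    simp only [Fintype.sum_prod_type, Prod.mk.injEq, ite_and]
    simp
  have h2 : ∀ b c, law P (fun ω => (g ω, k ω)) (b, c) =
      ∑ a, law P (fun ω => (f ω, g ω, k ω)) (a, b, c) :=
    fun b c => law_snd hall (b, c)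
  have h3 : ∀ c, law P k c = ∑ a, ∑ b, law P (fun ω => (f ω, g ω, k ω)) (a, b, c) := by
    intro c
    rw [law_snd (hf.prodMk hk) c]
    exact Finset.sum_congr rfl fun a _ => h1 a c
  have e1 : ent P (fun ω => (f ω, k ω)) = -∑ a, ∑ b, ∑ c,
      law P (fun ω => (f ω, g ω, k ω)) (a, b, c) *
        Real.log (law P (fun ω => (f ω, k ω)) (a, c)) := by
    simp only [ent, Fintype.sum_prod_type, Real.negMulLog, neg_mul, Finset.sum_neg_distrib]
    congr 1
    refine Finset.sum_congr rfl fun a _ => ?_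
    rw [Finset.sum_comm]
    refine Finset.sum_congr rfl fun c _ => ?_
    rw [← Finset.sum_mul, ← h1]
  have e2 : ent P (fun ω => (g ω, k ω)) = -∑ a, ∑ b, ∑ c,
      law P (fun ω => (f ω, g ω, k ω)) (a, b, c) *
        Real.log (law P (fun ω => (g ω, k ω)) (b, c)) := by
    simp only [ent, Fintype.sum_prod_type, Real.negMulLog, neg_mul, Finset.sum_neg_distrib]
    congr 1
    rw [Finset.sum_comm (s := (Finset.univ : Finset α))]
    refine Finset.sum_congr rfl fun b _ => ?_
    rw [Finset.sum_comm]
    refine Finset.sum_congr rfl fun c _ => ?_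
    rw [← Finset.sum_mul, ← h2]
  have e3 : ent P k = -∑ a, ∑ b, ∑ c,
      law P (fun ω => (f ω, g ω, k ω)) (a, b, c) * Real.log (law P k c) := by
    simp only [ent, Real.negMulLog, neg_mul, Finset.sum_neg_distrib]
    congr 1
    rw [sum_rotate]
    refine Finset.sum_congr rfl fun c _ => ?_
    simp_rw [← Finset.sum_mul]
    rw [← h3]
  have e4 : ent P (fun ω => (f ω, g ω, k ω)) = -∑ a, ∑ b, ∑ c,
      law P (fun ω => (f ω, g ω, k ω)) (a, b, c) *
        Real.log (law P (fun ω => (f ω, g ω, k ω)) (a, b, c)) := by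
    simp only [ent, Fintype.sum_prod_type, Real.negMulLog, neg_mul, Finset.sum_neg_distrib]
  rw [e1, e2, e3, e4]
  simp only [mul_sub, mul_add, Finset.sum_sub_distrib, Finset.sum_add_distrib]
  ring

/-- Strong subadditivity of the entropy. -/
theorem ent_submodular [Fintype α] [Fintype β] [Fintype γ] [IsProbabilityMeasure P]
    {f : Ω → α} {g : Ω → β} {k : Ω → γ} (hf : Discr f) (hg : Discr g) (hk : Discr k) :
    ent P (fun ω => (f ω, g ω, k ω)) + ent P k ≤
      ent P (fun ω => (f ω, k ω)) + ent P (fun ω => (g ω, k ω)) := by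
  have hall := hf.prodMk (hg.prodMk hk)
  have key : ∀ a b c, law P (fun ω => (f ω, g ω, k ω)) (a, b, c) -
      law P (fun ω => (f ω, k ω)) (a, c) * law P (fun ω => (g ω, k ω)) (b, c) / law P k c ≤
      law P (fun ω => (f ω, g ω, k ω)) (a, b, c) *
      (Real.log (law P (fun ω => (f ω, g ω, k ω)) (a, b, c)) + Real.log (law P k c) -
        Real.log (law P (fun ω => (f ω, k ω)) (a, c)) -
        Real.log (law P (fun ω => (g ω, k ω)) (b, c))) := by
    intro a b c
    have n1 := law_nonneg P (fun ω => (f ω, k ω)) (a, c)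
    have n2 := law_nonneg P (fun ω => (g ω, k ω)) (b, c)
    have n3 := law_nonneg P k c
    rcases (law_nonneg P (fun ω => (f ω, g ω, k ω)) (a, b, c)).eq_or_lt with h0 | h0
    · rw [← h0]
      simp only [zero_mul, zero_sub, Left.neg_nonpos_iff]
      positivity
    · have l1 : law P (fun ω => (f ω, g ω, k ω)) (a, b, c) ≤ law P (fun ω => (f ω, k ω)) (a, c) :=
        measureReal_mono (fun ω hω => by simp_all)
      have l2 : law P (fun ω => (f ω, g ω, k ω)) (a, b, c) ≤ law P (fun ω => (g ω, k ω)) (b, c) :=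
        measureReal_mono (fun ω hω => by simp_all)
      have l3 : law P (fun ω => (f ω, g ω, k ω)) (a, b, c) ≤ law P k c :=
        measureReal_mono (fun ω hω => by simp_all)
      generalize law P (fun ω => (f ω, g ω, k ω)) (a, b, c) = p at *
      generalize law P (fun ω => (f ω, k ω)) (a, c) = pac at *
      generalize law P (fun ω => (g ω, k ω)) (b, c) = pbc at *
      generalize law P k c = pc at *
      have p1 := h0.trans_le l1
      have p2 := h0.trans_le l2
      have p3 := h0.trans_le l3
      -- `log x ≤ x - 1` at the ratio of the conditionally independent mass to the true mass. Summed
      -- over all values, the resulting bound is `1 - 1`.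
      have := Real.log_le_sub_one_of_pos (x := pac * pbc / (p * pc)) (by positivity)
      rw [Real.log_div (by positivity) (by positivity), Real.log_mul p1.ne' p2.ne',
        Real.log_mul h0.ne' p3.ne'] at this
      have h2 := mul_le_mul_of_nonneg_left this h0.le
      have h3 : p * (pac * pbc / (p * pc) - 1) = pac * pbc / pc - p := by field_simp
      nlinarith
  have hsum := Finset.sum_le_sum fun a (_ : a ∈ Finset.univ) =>
    Finset.sum_le_sum fun b (_ : b ∈ Finset.univ) =>
      Finset.sum_le_sum fun c (_ : c ∈ Finset.univ) => key a b c
  rw [← mutualInfo_eq_sum hf hg hk] at hsum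
  have t1 : ∑ a, ∑ b, ∑ c, law P (fun ω => (f ω, g ω, k ω)) (a, b, c) = 1 := by
    rw [← sum_law (P := P) hall]; simp only [Fintype.sum_prod_type]
  have t2 : ∑ a, ∑ b, ∑ c, law P (fun ω => (f ω, k ω)) (a, c) *
      law P (fun ω => (g ω, k ω)) (b, c) / law P k c = 1 := by
    rw [sum_rotate, ← sum_law (P := P) hk]
    refine Finset.sum_congr rfl fun c _ => ?_
    simp_rw [← Finset.sum_div, ← Finset.mul_sum]
    rw [← law_snd (hg.prodMk hk) c, ← Finset.sum_mul, ← law_snd (hf.prodMk hk) c]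
    -- Values `c` of mass zero are covered by `x / 0 = 0`.
    exact mul_self_div_self _
  simp only [Finset.sum_sub_distrib] at hsum
  linarith

/-- `f` and `g` are conditionally independent given `k`. -/
def CondIndepGiven (P : Measure Ω) (f : Ω → α) (g : Ω → β) (k : Ω → γ) : Prop :=
  ∀ (s : Set α) (t : Set β) (c : γ),
    P.real (f ⁻¹' s ∩ g ⁻¹' t ∩ k ⁻¹' {c}) * P.real (k ⁻¹' {c}) =
      P.real (f ⁻¹' s ∩ k ⁻¹' {c}) * P.real (g ⁻¹' t ∩ k ⁻¹' {c})

theorem condIndepGiven_of_singleton [Fintype α] [Fintype β] [Finite γ] [IsFiniteMeasure P]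
    {f : Ω → α} {g : Ω → β} {k : Ω → γ} (hf : Discr f) (hg : Discr g) (hk : Discr k)
    (h : ∀ a b c, P.real (f ⁻¹' {a} ∩ g ⁻¹' {b} ∩ k ⁻¹' {c}) * P.real (k ⁻¹' {c}) =
      P.real (f ⁻¹' {a} ∩ k ⁻¹' {c}) * P.real (g ⁻¹' {b} ∩ k ⁻¹' {c})) :
    CondIndepGiven P f g k := by
  classical
  intro s t c
  have r : ∀ A : Set Ω, P.real (A ∩ k ⁻¹' {c}) = (P.restrict (k ⁻¹' {c})).real A := fun A => by
    rw [measureReal_restrict_apply' (hk _)]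
  have e1 : f ⁻¹' s ∩ g ⁻¹' t = (fun ω => (f ω, g ω)) ⁻¹' (s ×ˢ t) := by ext; simp
  rw [e1, r, r, r, measureReal_preimage_eq_sum (hf.prodMk hg), measureReal_preimage_eq_sum hf,
    measureReal_preimage_eq_sum hg, Finset.sum_mul_sum, Fintype.sum_prod_type, Finset.sum_mul]
  refine Finset.sum_congr rfl fun a _ => ?_
  rw [Finset.sum_mul]
  refine Finset.sum_congr rfl fun b _ => ?_
  have := h a b c
  have e2 : f ⁻¹' {a} ∩ g ⁻¹' {b} = (fun ω => (f ω, g ω)) ⁻¹' {(a, b)} := by ext; simp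
  rw [e2, r, r, r] at this
  by_cases ha : a ∈ s <;> by_cases hb : b ∈ t <;> simp [ha, hb, law, this]

/-- On each event `k = c` the new variables are functions of the old ones, so their events are
traces of events of `f` and `g`. The value of `k` may be used in these functions. -/
theorem CondIndepGiven.mono {α' β' : Type*} {f : Ω → α} {g : Ω → β} {k : Ω → γ}
    (h : CondIndepGiven P f g k) {f' : Ω → α'} {g' : Ω → β'}
    (hf : ∀ ω ω', k ω = k ω' → f ω = f ω' → f' ω = f' ω')
    (hg : ∀ ω ω', k ω = k ω' → g ω = g ω' → g' ω = g' ω') : CondIndepGiven P f' g' k := by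
  intro s t c
  have hs : f' ⁻¹' s ∩ k ⁻¹' {c} = f ⁻¹' {x | ∃ ω, f ω = x ∧ k ω = c ∧ f' ω ∈ s} ∩ k ⁻¹' {c} := by
    ext ω
    simp only [Set.mem_inter_iff, Set.mem_preimage, Set.mem_singleton_iff, Set.mem_ofPred_eq]
    refine ⟨fun ⟨h1, h2⟩ => ⟨⟨ω, rfl, h2, h1⟩, h2⟩, fun ⟨⟨ω', h1, h2, h3⟩, h4⟩ => ⟨?_, h4⟩⟩
    rwa [hf ω ω' (h4.trans h2.symm) h1.symm]
  have ht : g' ⁻¹' t ∩ k ⁻¹' {c} = g ⁻¹' {x | ∃ ω, g ω = x ∧ k ω = c ∧ g' ω ∈ t} ∩ k ⁻¹' {c} := by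
    ext ω
    simp only [Set.mem_inter_iff, Set.mem_preimage, Set.mem_singleton_iff, Set.mem_ofPred_eq]
    refine ⟨fun ⟨h1, h2⟩ => ⟨⟨ω, rfl, h2, h1⟩, h2⟩, fun ⟨⟨ω', h1, h2, h3⟩, h4⟩ => ⟨?_, h4⟩⟩
    rwa [hg ω ω' (h4.trans h2.symm) h1.symm]
  rw [Set.inter_inter_distrib_right, hs, ht, ← Set.inter_inter_distrib_right]
  exact h _ _ c

theorem CondIndepGiven.law_mul_law {f : Ω → α} {g : Ω → β} {k : Ω → γ}
    (h : CondIndepGiven P f g k) (a : α) (b : β) (c : γ) :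
    law P (fun ω => (f ω, g ω, k ω)) (a, b, c) * law P k c =
      law P (fun ω => (f ω, k ω)) (a, c) * law P (fun ω => (g ω, k ω)) (b, c) := by
  have := h {a} {b} c
  have e1 : f ⁻¹' {a} ∩ g ⁻¹' {b} ∩ k ⁻¹' {c} = (fun ω => (f ω, g ω, k ω)) ⁻¹' {(a, b, c)} := by
    ext; simp [and_assoc]
  have e2 : f ⁻¹' {a} ∩ k ⁻¹' {c} = (fun ω => (f ω, k ω)) ⁻¹' {(a, c)} := by ext; simp
  have e3 : g ⁻¹' {b} ∩ k ⁻¹' {c} = (fun ω => (g ω, k ω)) ⁻¹' {(b, c)} := by ext; simp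
  rw [e1, e2, e3] at this
  exact this

/-- The factorization makes the logarithmic density in `mutualInfo_eq_sum` vanish on the support. -/
theorem CondIndepGiven.ent_add_ent [Fintype α] [Fintype β] [Fintype γ] [IsProbabilityMeasure P]
    {f : Ω → α} {g : Ω → β} {k : Ω → γ} (h : CondIndepGiven P f g k) (hf : Discr f)
    (hg : Discr g) (hk : Discr k) :
    ent P (fun ω => (f ω, g ω, k ω)) + ent P k =
      ent P (fun ω => (f ω, k ω)) + ent P (fun ω => (g ω, k ω)) := by
  have := mutualInfo_eq_sum (P := P) hf hg hk
  have hz : ∀ a b c, law P (fun ω => (f ω, g ω, k ω)) (a, b, c) *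
      (Real.log (law P (fun ω => (f ω, g ω, k ω)) (a, b, c)) + Real.log (law P k c) -
        Real.log (law P (fun ω => (f ω, k ω)) (a, c)) -
        Real.log (law P (fun ω => (g ω, k ω)) (b, c))) = 0 := by
    intro a b c
    rcases (law_nonneg P (fun ω => (f ω, g ω, k ω)) (a, b, c)).eq_or_lt with h0 | h0
    · rw [← h0, zero_mul]
    · have l1 : law P (fun ω => (f ω, g ω, k ω)) (a, b, c) ≤ law P (fun ω => (f ω, k ω)) (a, c) :=
        measureReal_mono (fun ω hω => by simp_all)
      have l2 : law P (fun ω => (f ω, g ω, k ω)) (a, b, c) ≤ law P (fun ω => (g ω, k ω)) (b, c) :=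
        measureReal_mono (fun ω hω => by simp_all)
      have l3 : law P (fun ω => (f ω, g ω, k ω)) (a, b, c) ≤ law P k c :=
        measureReal_mono (fun ω hω => by simp_all)
      have := h.law_mul_law a b c
      rw [← Real.log_mul h0.ne' (h0.trans_le l3).ne', this,
        Real.log_mul (h0.trans_le l1).ne' (h0.trans_le l2).ne']
      ring
  simp only [hz, Finset.sum_const_zero] at this
  linarith

theorem ent_eq_of_law_eq [Fintype α] {f g : Ω → α} (h : ∀ a, law P f a = law P g a) :
    ent P f = ent P g := by simp only [ent, h]

/-- In this form, inequalities between conditional entropies become linear in values of `ent`. -/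
theorem condEntropy_mul_log_two [Fintype α] [Fintype β] [IsProbabilityMeasure P] {U : Ω → α}
    {Q : Ω → β} (hU : Discr U) (hQ : Discr Q) :
    condEntropy P U Q * Real.log 2 = ent P (fun ω => (U ω, Q ω)) - ent P Q := by
  have hset : ∀ u q, P.real {ω | U ω = u ∧ Q ω = q} = law P (fun ω => (U ω, Q ω)) (u, q) := by
    intro u q; congr 1; ext; simp
  have hsum : ∀ q, ∑ u, law P (fun ω => (U ω, Q ω)) (u, q) = law P Q q :=
    fun q => (law_snd (hU.prodMk hQ) q).symm
  have hlog : Real.log 2 ≠ 0 := (Real.log_pos one_lt_two).ne'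
  simp only [condEntropy, hset, hsum]
  have e : ent P Q = -∑ q, ∑ u, law P (fun ω => (U ω, Q ω)) (u, q) * Real.log (law P Q q) := by
    simp only [ent, Real.negMulLog, neg_mul, Finset.sum_neg_distrib]
    simp_rw [← Finset.sum_mul, hsum]
  rw [e, ent, Fintype.sum_prod_type, neg_mul, sub_neg_eq_add, Finset.sum_mul,
    Finset.sum_comm (s := (Finset.univ : Finset α)), ← Finset.sum_neg_distrib, ← Finset.sum_add_distrib]
  refine Finset.sum_congr rfl fun q _ => ?_
  rw [Finset.sum_mul, ← Finset.sum_neg_distrib, ← Finset.sum_add_distrib]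
  refine Finset.sum_congr rfl fun u _ => ?_
  rcases (law_nonneg P (fun ω => (U ω, Q ω)) (u, q)).eq_or_lt with h0 | h0
  · rw [← h0]; simp
  · have l3 : law P (fun ω => (U ω, Q ω)) (u, q) ≤ law P Q q :=
      measureReal_mono (fun ω hω => by simp_all)
    rw [Real.logb, Real.log_div h0.ne' (h0.trans_le l3).ne', Real.negMulLog]
    field_simp
    ring

end Shannon

/-! ## The binary entropy function and the single-step gain -/

section Gain

/-- The bound is `h(q) ≤ 3 √q`: the summand of `q` is at most `2 √q`, that of `1 - q` at most `q ≤
√q`. -/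
theorem binEntropy_sq_le {q : ℝ} (h0 : 0 ≤ q) (h1 : q ≤ 1 / 2) :
    Real.binEntropy q ^ 2 ≤ 9 * q := by
  have hs := Real.sq_sqrt h0
  have hs0 := Real.sqrt_nonneg q
  have a1 : Real.negMulLog q ≤ 2 * √q := by
    rcases h0.eq_or_lt with h | h
    · simp [← h]
    · have hp : 0 < √q := Real.sqrt_pos.2 h
      -- The point `1 / √q`, rather than `1 / q`, is what produces the square root.
      have := Real.log_le_sub_one_of_pos (x := (√q)⁻¹) (by positivity)
      rw [Real.log_inv] at this
      have h2 := mul_le_mul_of_nonneg_left this h.le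
      have h3 : q * ((√q)⁻¹ - 1) = √q - q := by
        field_simp
        linear_combination -hs
      have h4 : Real.log q = 2 * Real.log (√q) := by rw [Real.log_sqrt h.le]; ring
      rw [Real.negMulLog, h4]
      nlinarith
  have a2 : Real.negMulLog (1 - q) ≤ q := by
    have hp : 0 < 1 - q := by linarith
    have := Real.log_le_sub_one_of_pos (x := (1 - q)⁻¹) (by positivity)
    rw [Real.log_inv] at this
    have h2 := mul_le_mul_of_nonneg_left this hp.le
    have h3 : (1 - q) * ((1 - q)⁻¹ - 1) = q := by field_simp; ring
    rw [Real.negMulLog]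
    linarith
  have hle : q ≤ √q := by
    rw [Real.le_sqrt h0 h0]; nlinarith
  have hb : Real.binEntropy q ≤ 3 * √q := by
    rw [Real.binEntropy_eq_negMulLog_add_negMulLog_one_sub]; linarith
  have hb0 := Real.binEntropy_nonneg h0 (by linarith)
  nlinarith

/-- The convolution is the mixture of `p` and `1/2` with weights `1 - 2q` and `2q`, so concavity
gives a gain of `2q (log 2 - h(p))`. By `binEntropy_sq_le`, `2q ≥ 2 h(q)² / 9`, and `2/9 ≥ 1/5`. -/
theorem binEntropy_conv_ge_of_le_half {p q : ℝ} (hp0 : 0 ≤ p) (hp1 : p ≤ 1) (hq0 : 0 ≤ q)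
    (hq1 : q ≤ 1 / 2) :
    Real.binEntropy p + (Real.log 2 - Real.binEntropy p) * Real.binEntropy q ^ 2 / 5 ≤
      Real.binEntropy (p * (1 - q) + (1 - p) * q) := by
  have hmem : (2⁻¹ : ℝ) ∈ Set.Icc (0 : ℝ) 1 := by norm_num
  have hc := Real.strictConcave_binEntropy.concaveOn.2 (Set.mem_Icc.2 ⟨hp0, hp1⟩) hmem
    (show 0 ≤ 1 - 2 * q by linarith) (show 0 ≤ 2 * q by linarith) (by ring)
  simp only [smul_eq_mul, Real.binEntropy_two_inv] at hc
  have e : (1 - 2 * q) * p + 2 * q * 2⁻¹ = p * (1 - q) + (1 - p) * q := by ring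
  rw [e] at hc
  have h1 : 0 ≤ Real.log 2 - Real.binEntropy p := sub_nonneg.2 Real.binEntropy_le_log_two
  have h2 := binEntropy_sq_le hq0 hq1
  have h3 : (Real.log 2 - Real.binEntropy p) * Real.binEntropy q ^ 2 ≤
    (Real.log 2 - Real.binEntropy p) * (9 * q) := mul_le_mul_of_nonneg_left h2 h1
  nlinarith [mul_nonneg h1 hq0]

theorem binEntropy_conv_ge {p q : ℝ} (hp0 : 0 ≤ p) (hp1 : p ≤ 1) (hq0 : 0 ≤ q) (hq1 : q ≤ 1) :
    Real.binEntropy p + (Real.log 2 - Real.binEntropy p) * Real.binEntropy q ^ 2 / 5 ≤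
      Real.binEntropy (p * (1 - q) + (1 - p) * q) := by
  rcases le_total q (1 / 2) with h | h
  · exact binEntropy_conv_ge_of_le_half hp0 hp1 hq0 h
  · have := binEntropy_conv_ge_of_le_half (p := p) (q := 1 - q) hp0 hp1 (by linarith) (by linarith)
    rw [Real.binEntropy_one_sub] at this
    refine this.trans_eq ?_
    rw [← Real.binEntropy_one_sub]
    congr 1
    ring

theorem negMulLog_add_sub {x y : ℝ} (hx : 0 ≤ x) (hy : 0 ≤ y) :
    Real.negMulLog x + Real.negMulLog y - Real.negMulLog (x + y) =
      (x + y) * Real.binEntropy (y / (x + y)) := by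
  rcases (add_nonneg hx hy).eq_or_lt with h | h
  · have hx0 : x = 0 := by linarith
    have hy0 : y = 0 := by linarith
    rw [hx0, hy0]
    simp
  · have h1 : 1 - y / (x + y) = x / (x + y) := by field_simp; ring
    have key : ∀ z, 0 ≤ z →
        Real.negMulLog z = (x + y) * Real.negMulLog (z / (x + y)) - z * Real.log (x + y) := by
      intro z hz
      rcases hz.eq_or_lt with hz | hz
      · simp [← hz]
      · rw [Real.negMulLog, Real.negMulLog, Real.log_div hz.ne' h.ne']
        field_simp
        ring
    rw [Real.binEntropy_eq_negMulLog_add_negMulLog_one_sub, h1, key x hx, key y hy]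
    have h2 : Real.negMulLog (x + y) = -(x + y) * Real.log (x + y) := rfl
    rw [h2]
    ring

theorem sum_zmod_two (F : ZMod 2 → ℝ) : ∑ v, F v = F 0 + F 1 := Fin.sum_univ_two F

variable {Ω α δ : Type*} [MeasurableSpace Ω] {P : Measure Ω} [IsProbabilityMeasure P]
  [Fintype α] [Fintype δ]

theorem law_add_law {V : Ω → ZMod 2} {A : Ω → α} (hV : Discr V) (hA : Discr A) (a : α) :
    law P (fun ω => (V ω, A ω)) (0, a) + law P (fun ω => (V ω, A ω)) (1, a) = law P A a := by
  rw [law_snd (hV.prodMk hA) a, sum_zmod_two]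

/-- Conditional entropy of a bit as an average of the binary entropy function. -/
theorem condEntropy_bit {V : Ω → ZMod 2} {A : Ω → α} (hV : Discr V) (hA : Discr A) :
    condEntropy P V A * Real.log 2 = ∑ a, law P A a *
      Real.binEntropy (law P (fun ω => (V ω, A ω)) (1, a) / law P A a) := by
  rw [condEntropy_mul_log_two hV hA, ent, ent, Fintype.sum_prod_type_right,
    ← Finset.sum_sub_distrib]
  refine Finset.sum_congr rfl fun a _ => ?_
  rw [sum_zmod_two, ← law_add_law hV hA a]
  exact negMulLog_add_sub (law_nonneg _ _ _) (law_nonneg _ _ _)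

/-- If `V` and `W` are conditionally independent given `A` and `D`, and `A`, `D` are not too far
from independent, then the entropy of `V + W` exceeds that of `V` by a definite amount. -/
theorem condEntropy_add_ge {V W : Ω → ZMod 2} {A : Ω → α} {D : Ω → δ} (hV : Discr V)
    (hW : Discr W) (hA : Discr A) (hD : Discr D) {c : ℝ} (hc : 0 ≤ c)
    (hind : ∀ v a w d, law P (fun ω => ((V ω, A ω), (W ω, D ω))) ((v, a), (w, d)) *
      law P A a * law P D d = law P (fun ω => (V ω, A ω)) (v, a) *
        law P (fun ω => (W ω, D ω)) (w, d) * law P (fun ω => (A ω, D ω)) (a, d))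
    (hmix : ∀ a d, c * (law P A a * law P D d) ≤ law P (fun ω => (A ω, D ω)) (a, d)) :
    condEntropy P V A + c / 20 * ((1 - condEntropy P V A) * condEntropy P W D ^ 2) ≤
      condEntropy P (fun ω => V ω + W ω) (fun ω => (A ω, D ω)) := by
  classical
  have hAD := hA.prodMk hD
  have hVW : Discr (fun ω => V ω + W ω) := (hV.prodMk hW).comp fun x => x.1 + x.2
  have hlog := Real.log_pos one_lt_two
  have bV := condEntropy_bit (P := P) hV hA
  have bW := condEntropy_bit (P := P) hW hD
  have bS := condEntropy_bit (P := P) hVW hAD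
  have p01 : ∀ a, 0 ≤ law P (fun ω => (V ω, A ω)) (1, a) / law P A a ∧
      law P (fun ω => (V ω, A ω)) (1, a) / law P A a ≤ 1 := fun a =>
    ⟨div_nonneg (law_nonneg _ _ _) (law_nonneg _ _ _), div_le_one_of_le₀
      (by have := law_nonneg P (fun ω => (V ω, A ω)) (0, a)
          linarith [law_add_law (P := P) hV hA a]) (law_nonneg _ _ _)⟩
  have q01 : ∀ d, 0 ≤ law P (fun ω => (W ω, D ω)) (1, d) / law P D d ∧
      law P (fun ω => (W ω, D ω)) (1, d) / law P D d ≤ 1 := fun d =>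
    ⟨div_nonneg (law_nonneg _ _ _) (law_nonneg _ _ _), div_le_one_of_le₀
      (by have := law_nonneg P (fun ω => (W ω, D ω)) (0, d)
          linarith [law_add_law (P := P) hW hD d]) (law_nonneg _ _ _)⟩
  have hsum : ∀ a d, law P (fun ω => (V ω + W ω, A ω, D ω)) (1, a, d) =
      law P (fun ω => ((V ω, A ω), (W ω, D ω))) ((1, a), (0, d)) +
      law P (fun ω => ((V ω, A ω), (W ω, D ω))) ((0, a), (1, d)) := by
    intro a d
    have := law_comp (P := P) ((hV.prodMk hA).prodMk (hW.prodMk hD))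
      (fun x => (x.1.1 + x.2.1, x.1.2, x.2.2)) (1, a, d)
    simp only at this
    rw [this]
    simp only [Fintype.sum_prod_type, Prod.mk.injEq, sum_zmod_two]
    have h11 : (1 : ZMod 2) + 1 ≠ 1 := by decide
    simp [ite_and, h11]
    ring
  -- Given `(a, d)`, conditional independence turns the law of `V + W` into the binary convolution
  -- of the two conditional probabilities.
  have hconv : ∀ a d, 0 < law P (fun ω => (A ω, D ω)) (a, d) →
      law P (fun ω => (V ω + W ω, A ω, D ω)) (1, a, d) / law P (fun ω => (A ω, D ω)) (a, d) =
      law P (fun ω => (V ω, A ω)) (1, a) / law P A a *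
        (1 - law P (fun ω => (W ω, D ω)) (1, d) / law P D d) +
      (1 - law P (fun ω => (V ω, A ω)) (1, a) / law P A a) *
        (law P (fun ω => (W ω, D ω)) (1, d) / law P D d) := by
    intro a d h0
    have hA0 : 0 < law P A a := h0.trans_le (measureReal_mono (fun ω hω => by simp_all))
    have hD0 : 0 < law P D d := h0.trans_le (measureReal_mono (fun ω hω => by simp_all))
    have i1 := hind 1 a 0 d
    have i2 := hind 0 a 1 d
    have s1 := law_add_law (P := P) hV hA a
    have s2 := law_add_law (P := P) hW hD d
    rw [hsum]
    have t1 : 1 - law P (fun ω => (W ω, D ω)) (1, d) / law P D d =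
        law P (fun ω => (W ω, D ω)) (0, d) / law P D d := by field_simp; linarith
    have t2 : 1 - law P (fun ω => (V ω, A ω)) (1, a) / law P A a =
        law P (fun ω => (V ω, A ω)) (0, a) / law P A a := by field_simp; linarith
    rw [t1, t2]
    field_simp
    linear_combination i1 + i2
  set h : α → ℝ := fun a => Real.binEntropy (law P (fun ω => (V ω, A ω)) (1, a) / law P A a)
    with hh
  set g : δ → ℝ := fun d => Real.binEntropy (law P (fun ω => (W ω, D ω)) (1, d) / law P D d)
    with hg
  have hle : ∀ a, h a ≤ Real.log 2 := fun a => Real.binEntropy_le_log_two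
  have hterm : ∀ a d, law P (fun ω => (A ω, D ω)) (a, d) * h a +
      c * (law P A a * law P D d) * ((Real.log 2 - h a) * g d ^ 2 / 5) ≤
      law P (fun ω => (A ω, D ω)) (a, d) * Real.binEntropy
        (law P (fun ω => (V ω + W ω, A ω, D ω)) (1, a, d) /
          law P (fun ω => (A ω, D ω)) (a, d)) := by
    intro a d
    have hnn : 0 ≤ (Real.log 2 - h a) * g d ^ 2 / 5 :=
      div_nonneg (mul_nonneg (sub_nonneg.2 (hle a)) (sq_nonneg _)) (by norm_num)
    have m := mul_le_mul_of_nonneg_right (hmix a d) hnn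
    rcases (law_nonneg P (fun ω => (A ω, D ω)) (a, d)).eq_or_lt with h0 | h0
    -- If the pair has joint mass zero, the mixing bound already forces the gain term to be at most
    -- zero.
    · rw [← h0] at m ⊢
      simp only [zero_mul, zero_add] at m ⊢
      exact m
    · rw [hconv a d h0]
      have := mul_le_mul_of_nonneg_left (binEntropy_conv_ge (p01 a).1 (p01 a).2 (q01 d).1 (q01 d).2)
        h0.le
      rw [mul_add] at this
      change law P (fun ω => (A ω, D ω)) (a, d) * h a + law P (fun ω => (A ω, D ω)) (a, d) *
        ((Real.log 2 - h a) * g d ^ 2 / 5) ≤ _ at this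
      linarith
  have hsumm := Finset.sum_le_sum fun a (_ : a ∈ Finset.univ) =>
    Finset.sum_le_sum fun d (_ : d ∈ Finset.univ) => hterm a d
  rw [Fintype.sum_prod_type] at bS
  rw [← bS] at hsumm
  simp only [Finset.sum_add_distrib] at hsumm
  have e1 : ∑ a, ∑ d, law P (fun ω => (A ω, D ω)) (a, d) * h a =
      condEntropy P V A * Real.log 2 := by
    rw [bV]
    refine Finset.sum_congr rfl fun a _ => ?_
    rw [← Finset.sum_mul, ← law_fst hAD a]
  have e2 : ∑ a, ∑ d, c * (law P A a * law P D d) * ((Real.log 2 - h a) * g d ^ 2 / 5) =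
      c / 5 * ((Real.log 2 - condEntropy P V A * Real.log 2) * ∑ d, law P D d * g d ^ 2) := by
    have : Real.log 2 - condEntropy P V A * Real.log 2 = ∑ a, law P A a * (Real.log 2 - h a) := by
      rw [bV]
      simp only [mul_sub, Finset.sum_sub_distrib, ← Finset.sum_mul, sum_law hA, one_mul]
      rfl
    rw [this, Finset.sum_mul_sum, Finset.mul_sum]
    refine Finset.sum_congr rfl fun a _ => ?_
    rw [Finset.mul_sum]
    exact Finset.sum_congr rfl fun d _ => by ring
  -- The variance of `g` is nonnegative, so its second moment dominates the square of its mean.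
  have e3 : (condEntropy P W D * Real.log 2) ^ 2 ≤ ∑ d, law P D d * g d ^ 2 := by
    have hz : 0 ≤ ∑ d, law P D d * (g d - condEntropy P W D * Real.log 2) ^ 2 :=
      Finset.sum_nonneg fun d _ => mul_nonneg (law_nonneg _ _ _) (sq_nonneg _)
    have hx : ∑ d, law P D d * (g d - condEntropy P W D * Real.log 2) ^ 2 =
        ∑ d, law P D d * g d ^ 2 - 2 * (condEntropy P W D * Real.log 2) * (∑ d, law P D d * g d) +
          (condEntropy P W D * Real.log 2) ^ 2 * ∑ d, law P D d := by
      rw [Finset.mul_sum, Finset.mul_sum, ← Finset.sum_sub_distrib, ← Finset.sum_add_distrib]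
      exact Finset.sum_congr rfl fun d _ => by ring
    rw [hx, sum_law hD, ← bW] at hz
    linarith
  rw [e1, e2] at hsumm
  have hx1 : 0 ≤ Real.log 2 - condEntropy P V A * Real.log 2 := by
    rw [bV]
    have : ∑ a, law P A a * h a ≤ ∑ a, law P A a * Real.log 2 :=
      Finset.sum_le_sum fun a _ => mul_le_mul_of_nonneg_left (hle a) (law_nonneg _ _ _)
    rw [← Finset.sum_mul, sum_law hA, one_mul] at this
    exact sub_nonneg.2 this
  have m1 := mul_le_mul_of_nonneg_left (mul_le_mul_of_nonneg_left e3 hx1)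
    (by positivity : 0 ≤ c / 5)
  have hHV : 0 ≤ 1 - condEntropy P V A := by
    by_contra! hneg
    nlinarith
  -- The change from nats to bits leaves a factor `(log 2)² ≥ 1/4`, which turns the constant `5`
  -- into `20`.
  have hl : 1 / 4 ≤ Real.log 2 ^ 2 := by
    have := Real.log_two_gt_d9
    nlinarith
  have m2 : c / 20 * ((1 - condEntropy P V A) * condEntropy P W D ^ 2) ≤
      c / 5 * ((1 - condEntropy P V A) * condEntropy P W D ^ 2) * Real.log 2 ^ 2 := by
    have : 0 ≤ c / 5 * ((1 - condEntropy P V A) * condEntropy P W D ^ 2) := by positivity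
    nlinarith
  have fin : (condEntropy P V A + c / 20 * ((1 - condEntropy P V A) * condEntropy P W D ^ 2)) *
      Real.log 2 ≤ condEntropy P (fun ω => V ω + W ω) (fun ω => (A ω, D ω)) * Real.log 2 := by
    have := mul_le_mul_of_nonneg_right m2 hlog.le
    nlinarith
  exact le_of_mul_le_mul_right fin hlog

end Gain

/-! ## Stationarity, Markov property and mixing of FAIM processes -/

section FAIMProcess

/-- The process shifted by `t`. -/
def sh {Ω α : Type*} (t : ℤ) (X : ℤ → Ω → α) : ℤ → Ω → α := fun j => X (j + t)

variable {Ω 𝒴 𝒮 : Type*} [MeasurableSpace Ω] [Fintype 𝒴] [Fintype 𝒮]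
  {P : Measure Ω} [IsProbabilityMeasure P]
  {X : ℤ → Ω → ZMod 2} {Y : ℤ → Ω → 𝒴} {S : ℤ → Ω → 𝒮}

omit [Fintype 𝒴] [Fintype 𝒮] [IsProbabilityMeasure P] in
theorem IsFAIM.discr_X (h : IsFAIM P X Y S) (j : ℤ) : Discr (X j) :=
  discr_of_singleton (h.measurable_X j)

omit [Fintype 𝒮] [IsProbabilityMeasure P] in
theorem IsFAIM.discr_Y (h : IsFAIM P X Y S) (j : ℤ) : Discr (Y j) :=
  discr_of_singleton (h.measurable_Y j)

omit [Fintype 𝒴] [IsProbabilityMeasure P] in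
theorem IsFAIM.discr_S (h : IsFAIM P X Y S) (j : ℤ) : Discr (S j) :=
  discr_of_singleton (h.measurable_S j)

/-- The two blocks of length `N` starting after time `t`, with their boundary states. -/
def blockWin (X : ℤ → Ω → ZMod 2) (Y : ℤ → Ω → 𝒴) (S : ℤ → Ω → 𝒮) (t : ℤ) (N : ℕ) (ω : Ω) :
    (Fin N → ZMod 2) × (Fin N → 𝒴) × 𝒮 × 𝒮 :=
  (block (sh t X) N ω, block (sh t Y) N ω, S (t + N) ω, S t ω)

omit [Fintype 𝒴] [Fintype 𝒮] [IsProbabilityMeasure P] in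
theorem IsFAIM.discr_block_X (h : IsFAIM P X Y S) (t : ℤ) (N : ℕ) :
    Discr (block (sh t X) N) := Discr.pi fun _ => h.discr_X _

omit [Fintype 𝒮] [IsProbabilityMeasure P] in
theorem IsFAIM.discr_block_Y (h : IsFAIM P X Y S) (t : ℤ) (N : ℕ) :
    Discr (block (sh t Y) N) := Discr.pi fun _ => h.discr_Y _

theorem IsFAIM.law_blockWin (h : IsFAIM P X Y S) {α : Type*} (t : ℤ) (N : ℕ)
    (e : (Fin N → ZMod 2) × (Fin N → 𝒴) × 𝒮 × 𝒮 → α) (a : α) :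
    law P (fun ω => e (blockWin X Y S t N ω)) a = law P (fun ω => e (blockWin X Y S 0 N ω)) a := by
  classical
  -- The block occupies the times `t + 1, …, t + N`, but `S t` is needed too. The window therefore
  -- has `N + 1` entries, of which entry `0` supplies only its state.
  let win : ℤ → Ω → (Fin (N + 1) → ZMod 2 × 𝒴 × 𝒮) := fun t ω j =>
    (X ((j : ℕ) + t) ω, Y ((j : ℕ) + t) ω, S ((j : ℕ) + t) ω)
  have hwin : ∀ t, Discr (win t) := fun t => Discr.pi fun j =>
    (h.discr_X _).prodMk ((h.discr_Y _).prodMk (h.discr_S _))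
  have hlaw : ∀ z, law P (win t) z = law P (win 0) z := by
    intro z
    have := h.stationary t (Finset.univ.image fun j : Fin (N + 1) => ((j : ℕ) : ℤ))
      (fun j => if hj : j.toNat < N + 1 then z ⟨j.toNat, hj⟩ else z 0)
    have e1 : ∀ s, win s ⁻¹' {z} = {ω | ∀ j ∈ Finset.univ.image fun j : Fin (N + 1) =>
        ((j : ℕ) : ℤ), (X (j + s) ω, Y (j + s) ω, S (j + s) ω) =
          (if hj : j.toNat < N + 1 then z ⟨j.toNat, hj⟩ else z 0)} := by
      intro s
      have hle : ∀ x : Fin (N + 1), (x : ℕ) ≤ N := fun x => by omega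
      ext ω
      simp [win, funext_iff, hle]
    have e0 := e1 0
    simp only [add_zero] at e0
    simp only [law, measureReal_def]
    rw [e1, e0, this]
  let e' : (Fin (N + 1) → ZMod 2 × 𝒴 × 𝒮) → (Fin N → ZMod 2) × (Fin N → 𝒴) × 𝒮 × 𝒮 := fun z =>
    (fun j => (z j.succ).1, fun j => (z j.succ).2.1, (z (Fin.last N)).2.2, (z 0).2.2)
  have he : ∀ s, (fun ω => e (blockWin X Y S s N ω)) = fun ω => (fun z => e (e' z)) (win s ω) := by
    intro s
    funext ω
    simp only
    congr 1
    simp [blockWin, e', win, block, sh, add_comm, Prod.ext_iff, funext_iff]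
  rw [he, he, law_comp (hwin t) fun z => e (e' z), law_comp (hwin 0) fun z => e (e' z)]
  simp only [hlaw]

/-- The Markov property, for functions of finitely many past and future variables. -/
theorem IsFAIM.condIndep (h : IsFAIM P X Y S) {α β : Type*} (t : ℤ) (M : ℕ) {f : Ω → α}
    {g : Ω → β}
    (hf : ∀ ω ω', S t ω = S t ω' → (∀ l, t - M < l → l ≤ t →
      X l ω = X l ω' ∧ Y l ω = Y l ω' ∧ S (l - 1) ω = S (l - 1) ω') → f ω = f ω')
    (hg : ∀ ω ω', S t ω = S t ω' → (∀ l, t < l → l ≤ t + M →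
      X l ω = X l ω' ∧ Y l ω = Y l ω' ∧ S l ω = S l ω') → g ω = g ω') :
    CondIndepGiven P f g (S t) := by
  classical
  -- Past entries carry `S (l - 1)` and future entries `S l`, in accordance with the field `markov`.
  let pa : Ω → (Fin M → ZMod 2 × 𝒴 × 𝒮) := fun ω j =>
    (X (t - (j : ℕ)) ω, Y (t - (j : ℕ)) ω, S (t - (j : ℕ) - 1) ω)
  let fu : Ω → (Fin M → ZMod 2 × 𝒴 × 𝒮) := fun ω j =>
    (X (t + 1 + (j : ℕ)) ω, Y (t + 1 + (j : ℕ)) ω, S (t + 1 + (j : ℕ)) ω)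
  have hpa : Discr pa := Discr.pi fun j =>
    (h.discr_X _).prodMk ((h.discr_Y _).prodMk (h.discr_S _))
  have hfu : Discr fu := Discr.pi fun j =>
    (h.discr_X _).prodMk ((h.discr_Y _).prodMk (h.discr_S _))
  have main : CondIndepGiven P pa fu (S t) := by
    refine condIndepGiven_of_singleton hpa hfu (h.discr_S t) fun a b c => ?_
    -- For `M = 0` no entry is available as the value outside the window; both variables are then
    -- constant.
    rcases Nat.eq_zero_or_pos M with hM | hM
    · subst hM
      have e1 : pa ⁻¹' {a} = Set.univ := by
        ext ω; simp [Subsingleton.elim (pa ω) a]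
      have e2 : fu ⁻¹' {b} = Set.univ := by
        ext ω; simp [Subsingleton.elim (fu ω) b]
      rw [e1, e2, Set.univ_inter, Set.univ_inter]
    have hm := h.markov (t + 1) c
      (Finset.univ.image fun j : Fin M => t + 1 + ((j : ℕ) : ℤ))
      (Finset.univ.image fun j : Fin M => t - ((j : ℕ) : ℤ))
      (by simp; intro; omega) (by simp)
      (fun k => if hj : (k - (t + 1)).toNat < M then b ⟨(k - (t + 1)).toNat, hj⟩ else b ⟨0, hM⟩)
      (fun k => if hj : (t - k).toNat < M then a ⟨(t - k).toNat, hj⟩ else a ⟨0, hM⟩)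
    have hm' := congrArg ENNReal.toReal hm
    simp only [ENNReal.toReal_mul, add_sub_cancel_right] at hm'
    simp only [measureReal_def]
    rw [mul_comm, mul_comm (P _).toReal (P (fu ⁻¹' {b} ∩ _)).toReal]
    convert hm' using 4 <;> ext ω <;>
      simp [pa, fu, funext_iff, and_comm]
  refine main.mono (fun ω ω' hk hp => hf ω ω' hk fun l h1 h2 => ?_)
    (fun ω ω' hk hp => hg ω ω' hk fun l h1 h2 => ?_)
  · have := congrFun hp ⟨(t - l).toNat, by omega⟩
    have e : ((t - l).toNat : ℤ) = t - l := by omega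
    simpa [pa, e] using this
  · have := congrFun hp ⟨(l - (t + 1)).toNat, by omega⟩
    have e : ((l - (t + 1)).toNat : ℤ) = l - (t + 1) := by omega
    simpa [fu, e] using this

/-! ### The state chain: transition laws, primitivity and mixing -/

theorem IsFAIM.law_S (h : IsFAIM P X Y S) (t : ℤ) (a : 𝒮) : law P (S t) a = law P (S 0) a :=
  h.law_blockWin t 0 (fun x => x.2.2.2) a

theorem IsFAIM.law_S_S (h : IsFAIM P X Y S) (t : ℤ) (n : ℕ) (a b : 𝒮) :
    law P (fun ω => (S t ω, S (t + n) ω)) (a, b) = law P (fun ω => (S 0 ω, S n ω)) (a, b) := by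
  have := h.law_blockWin t n (fun x => (x.2.2.2, x.2.2.1)) (a, b)
  simpa [blockWin] using this

omit [Fintype 𝒴] [Fintype 𝒮] [IsProbabilityMeasure P] in
theorem transProb_eq (n : ℕ) (a b : 𝒮) :
    transProb P S n a b = law P (fun ω => (S 0 ω, S n ω)) (a, b) / law P (S 0) a := by
  simp only [transProb, law]
  congr 2
  ext; simp

omit [Fintype 𝒴] [Fintype 𝒮] [IsProbabilityMeasure P] in
-- `transProb` is a quotient by this mass, so with `x / 0 = 0` a null state would contradict
-- irreducibility.
theorem IsFAIM.law_S_pos (h : IsFAIM P X Y S) (a : 𝒮) : 0 < law P (S 0) a := by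
  obtain ⟨n, -, hn⟩ := h.irreducible a a
  rw [transProb_eq] at hn
  refine (law_nonneg P (S 0) a).lt_of_ne fun h0 => ?_
  rw [← h0, div_zero] at hn
  exact lt_irrefl _ hn

/-- The Chapman–Kolmogorov equation. -/
theorem IsFAIM.law_S_S_add (h : IsFAIM P X Y S) (m n : ℕ) (a b : 𝒮) :
    law P (fun ω => (S 0 ω, S ((m + n : ℕ) : ℤ) ω)) (a, b) =
      ∑ s, law P (fun ω => (S 0 ω, S m ω)) (a, s) * law P (fun ω => (S 0 ω, S n ω)) (s, b) /
        law P (S 0) s := by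
  classical
  have hci : CondIndepGiven P (S 0) (S ((m + n : ℕ) : ℤ)) (S (m : ℤ)) := by
    refine h.condIndep m (m + n) (fun ω ω' h1 h2 => ?_) (fun ω ω' h1 h2 => ?_)
    · rcases Nat.eq_zero_or_pos m with rfl | hm
      · exact h1
      · simpa using (h2 1 (by push_cast; omega) (by omega)).2.2
    · rcases Nat.eq_zero_or_pos n with rfl | hn
      · exact h1
      · exact (h2 ((m + n : ℕ) : ℤ) (by push_cast; omega) (by push_cast; omega)).2.2
  rw [law_fst (((h.discr_S 0).prodMk (h.discr_S ((m + n : ℕ) : ℤ))).prodMk (h.discr_S (m : ℤ)))]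
  refine Finset.sum_congr rfl fun s _ => ?_
  have e1 := hci.law_mul_law a b s
  rw [show law P (fun ω => (S 0 ω, S ((m + n : ℕ) : ℤ) ω, S m ω)) (a, b, s) =
    law P (fun ω => ((S 0 ω, S ((m + n : ℕ) : ℤ) ω), S m ω)) ((a, b), s) from
      congrArg P.real (by ext; simp [and_assoc])] at e1
  rw [eq_div_iff (h.law_S_pos s).ne', ← h.law_S m s, e1]
  congr 1
  have := h.law_S_S m n s b
  rw [← this, Nat.cast_add]
  exact congrArg P.real (by ext; simp [and_comm])

theorem IsFAIM.law_S_S_add_ge (h : IsFAIM P X Y S) (m n : ℕ) (a s b : 𝒮) :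
    law P (fun ω => (S 0 ω, S m ω)) (a, s) * law P (fun ω => (S 0 ω, S n ω)) (s, b) /
        law P (S 0) s ≤ law P (fun ω => (S 0 ω, S ((m + n : ℕ) : ℤ) ω)) (a, b) := by
  rw [h.law_S_S_add]
  exact Finset.single_le_sum (f := fun s => law P (fun ω => (S 0 ω, S m ω)) (a, s) *
    law P (fun ω => (S 0 ω, S n ω)) (s, b) / law P (S 0) s)
    (fun i _ => div_nonneg (mul_nonneg (law_nonneg _ _ _) (law_nonneg _ _ _)) (law_nonneg _ _ _))
    (Finset.mem_univ s)

theorem IsFAIM.law_S_S_add_pos (h : IsFAIM P X Y S) {m n : ℕ} {a s b : 𝒮}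
    (h1 : 0 < law P (fun ω => (S 0 ω, S m ω)) (a, s))
    (h2 : 0 < law P (fun ω => (S 0 ω, S n ω)) (s, b)) :
    0 < law P (fun ω => (S 0 ω, S ((m + n : ℕ) : ℤ) ω)) (a, b) :=
  (div_pos (mul_pos h1 h2) (h.law_S_pos s)).trans_le (h.law_S_S_add_ge m n a s b)

omit [Fintype 𝒴] [Fintype 𝒮] [IsProbabilityMeasure P] in
theorem IsFAIM.transProb_pos_iff (h : IsFAIM P X Y S) {n : ℕ} {a b : 𝒮} :
    0 < transProb P S n a b ↔ 0 < law P (fun ω => (S 0 ω, S n ω)) (a, b) := by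
  rw [transProb_eq, div_pos_iff_of_pos_right (h.law_S_pos a)]

/-- The transition matrix of the state chain is primitive. -/
theorem IsFAIM.exists_forall_pos (h : IsFAIM P X Y S) :
    ∃ n₀ : ℕ, ∀ n ≥ n₀, ∀ a b, 0 < law P (fun ω => (S 0 ω, S n ω)) (a, b) := by
  have hret : ∀ a, ∃ n₀ : ℕ, ∀ n ≥ n₀, 0 < law P (fun ω => (S 0 ω, S n ω)) (a, a) := by
    intro a
    -- Return times are closed under addition, and a set of natural numbers with gcd `1` additively
    -- generates all large ones.
    obtain ⟨n₀, hn₀⟩ := Nat.exists_mem_closure_of_ge {n : ℕ | 1 ≤ n ∧ 0 < transProb P S n a a}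
    refine ⟨n₀, fun n hn => ?_⟩
    have hmem := hn₀ n hn (by rw [h.aperiodic a]; exact one_dvd _)
    clear hn
    induction hmem using AddSubmonoid.closure_induction with
    | mem x hx => exact h.transProb_pos_iff.1 hx.2
    | zero =>
      refine (h.law_S_pos a).trans_eq ?_
      exact congrArg P.real (by ext; simp)
    | add x y _ _ hx hy => exact h.law_S_S_add_pos hx hy
  choose r hr using hret
  have hirr : ∀ a b, ∃ n : ℕ, 0 < law P (fun ω => (S 0 ω, S n ω)) (a, b) := fun a b => by
    obtain ⟨n, -, hn⟩ := h.irreducible a b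
    exact ⟨n, h.transProb_pos_iff.1 hn⟩
  choose k hk using hirr
  -- The threshold leaves room for a return to `a` of length `n - k a b ≥ r a`, followed by a
  -- passage to `b` of length `k a b`.
  refine ⟨∑ a, r a + ∑ a, ∑ b, k a b, fun n hn a b => ?_⟩
  have h1 : r a ≤ ∑ a, r a := Finset.single_le_sum (fun _ _ => Nat.zero_le _) (Finset.mem_univ a)
  have h2 : k a b ≤ ∑ a, ∑ b, k a b :=
    (Finset.single_le_sum (f := fun b => k a b) (fun _ _ => Nat.zero_le _)
      (Finset.mem_univ b)).trans
    (Finset.single_le_sum (f := fun a => ∑ b, k a b) (fun _ _ => Nat.zero_le _)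
      (Finset.mem_univ a))
  have h3 := h.law_S_S_add_pos (hr a (n - k a b) (by omega)) (hk a b)
  rwa [Nat.sub_add_cancel (by omega)] at h3

/-- Far apart states are not too far from independent. -/
theorem IsFAIM.exists_mixing (h : IsFAIM P X Y S) :
    ∃ c : ℝ, 0 < c ∧ ∃ n₀ : ℕ, ∀ n ≥ n₀, ∀ (t : ℤ) (a b : 𝒮),
      c * (law P (S 0) a * law P (S 0) b) ≤ law P (fun ω => (S t ω, S (t + n) ω)) (a, b) := by
  classical
  obtain ⟨n₀, hn₀⟩ := h.exists_forall_pos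
  have : Nonempty 𝒮 := P.nonempty_of_neZero.map (S 0)
  -- The mixing constant is the smallest entry of the joint law at lag `n₀`. A lag `m + n₀` is split
  -- so that its last `n₀` steps supply this factor.
  obtain ⟨⟨a₀, b₀⟩, hmin⟩ := Finite.exists_min
    (fun x : 𝒮 × 𝒮 => law P (fun ω => (S 0 ω, S n₀ ω)) x)
  refine ⟨law P (fun ω => (S 0 ω, S n₀ ω)) (a₀, b₀), hn₀ n₀ le_rfl _ _, n₀, fun n hn t a b => ?_⟩
  have hc := hn₀ n₀ le_rfl a₀ b₀
  set c := law P (fun ω => (S 0 ω, S n₀ ω)) (a₀, b₀)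
  rw [h.law_S_S]
  obtain ⟨m, rfl⟩ := Nat.exists_eq_add_of_le' hn
  rw [h.law_S_S_add]
  have hterm : ∀ s, law P (fun ω => (S 0 ω, S m ω)) (a, s) * c ≤
      law P (fun ω => (S 0 ω, S m ω)) (a, s) * law P (fun ω => (S 0 ω, S n₀ ω)) (s, b) /
        law P (S 0) s := by
    intro s
    rw [le_div_iff₀ (h.law_S_pos s), mul_assoc]
    refine mul_le_mul_of_nonneg_left ?_ (law_nonneg _ _ _)
    have h1 := hmin (s, b)
    have h2 := law_le_one P (S 0) s
    nlinarith
  refine le_trans ?_ (Finset.sum_le_sum fun s _ => hterm s)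
  rw [← Finset.sum_mul, ← law_fst ((h.discr_S 0).prodMk (h.discr_S m)) a]
  have h1 := law_nonneg P (S 0) a
  have h2 := law_le_one P (S 0) b
  have h3 := mul_le_mul_of_nonneg_left h2 h1
  nlinarith

end FAIMProcess

/-! ## The recursive structure of the polarization transform -/

section Recursion

/-- The index `2 i + b` at the next level. -/
def child {n : ℕ} (i : Fin (2 ^ n)) (b : Fin 2) : Fin (2 ^ (n + 1)) := finProdFinEquiv (i, b)

theorem child_val {n : ℕ} (i : Fin (2 ^ n)) (b : Fin 2) : (child i b : ℕ) = b + 2 * i := rfl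

theorem exists_child {n : ℕ} (k : Fin (2 ^ (n + 1))) : ∃ i b, k = child i b :=
  ⟨(finProdFinEquiv.symm k).1, (finProdFinEquiv.symm k).2,
    ((finProdFinEquiv (m := 2 ^ n) (n := 2)).apply_symm_apply k).symm⟩

theorem sum_child {n : ℕ} (F : Fin (2 ^ (n + 1)) → ℝ) :
    ∑ k, F k = ∑ i : Fin (2 ^ n), (F (child i 0) + F (child i 1)) := by
  refine ((finProdFinEquiv (m := 2 ^ n) (n := 2)).sum_comp F).symm.trans ?_
  rw [Fintype.sum_prod_type]
  exact Finset.sum_congr rfl fun i _ => Fin.sum_univ_two _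

/-- The position of the `k`-th entry of the `a`-th half. -/
def halfEquiv (n : ℕ) : Fin 2 × Fin (2 ^ n) ≃ Fin (2 ^ (n + 1)) :=
  finProdFinEquiv.trans (finCongr (by ring))

theorem halfEquiv_val (n : ℕ) (a : Fin 2) (k : Fin (2 ^ n)) :
    (halfEquiv n (a, k) : ℕ) = k + 2 ^ n * a := rfl

theorem bitRev_finFunction (n : ℕ) (f : Fin n → Fin 2) :
    bitRev n (finFunctionFinEquiv f) = finFunctionFinEquiv (f ∘ Fin.rev) := by
  simp only [bitRev, Equiv.trans_apply, Equiv.symm_apply_apply]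
  rfl

/-- The most significant digit selects the half of the block. Bit reversal makes it the least
significant digit, on which the last Kronecker factor `G₂` acts. -/
theorem bitRev_halfEquiv (n : ℕ) (a : Fin 2) (k : Fin (2 ^ n)) :
    bitRev (n + 1) (halfEquiv n (a, k)) = child (bitRev n k) a := by
  obtain ⟨f, rfl⟩ := finFunctionFinEquiv.surjective k
  have h1 : halfEquiv n (a, finFunctionFinEquiv f) =
      finFunctionFinEquiv (Fin.snoc (α := fun _ => Fin 2) f a) := by
    apply Fin.ext
    rw [halfEquiv_val, finFunctionFinEquiv_apply, finFunctionFinEquiv_apply,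
      Fin.sum_univ_castSucc]
    simp [mul_comm]
  rw [h1, bitRev_finFunction, bitRev_finFunction]
  apply Fin.ext
  rw [child_val, finFunctionFinEquiv_apply, finFunctionFinEquiv_apply, Fin.sum_univ_succ,
    Finset.mul_sum]
  simp only [Function.comp_apply, Fin.rev_zero, Fin.snoc_last, Fin.val_zero, pow_zero, mul_one,
    Fin.rev_succ, Fin.snoc_castSucc, Fin.val_succ, pow_succ]
  congr 1
  exact Finset.sum_congr rfl fun i _ => by ring

theorem kronPow_child (n : ℕ) (i j : Fin (2 ^ n)) (a b : Fin 2) :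
    kronPow (n + 1) (child i a) (child j b) = kronPow n i j * G₂ a b := by
  simp [kronPow, child, Matrix.kroneckerMap_apply]

theorem polarMatrix_apply (n : ℕ) (k j : Fin (2 ^ n)) :
    polarMatrix n k j = kronPow n (bitRev n k) j := by
  rw [polarMatrix, Equiv.Perm.permMatrix, PEquiv.toMatrix_toPEquiv_mul]
  rfl

variable {Ω 𝒴 𝒮 : Type*}

theorem sh_sh {α : Type*} (s t : ℤ) (X : ℤ → Ω → α) : sh s (sh t X) = sh (s + t) X := by
  funext j; simp [sh, add_assoc]

theorem sh_zero {α : Type*} (X : ℤ → Ω → α) : sh 0 X = X := by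
  funext j; simp [sh]

/-- By `bitRev_halfEquiv` and `kronPow_child`, each half is transformed by the matrix of level `n`,
and `G₂` combines the two results. -/
theorem polarU_child (X : ℤ → Ω → ZMod 2) (n : ℕ) (i : Fin (2 ^ n)) (b : Fin 2) (ω : Ω) :
    polarU X (n + 1) (child i b) ω =
      polarU X n i ω * G₂ 0 b + polarU (sh (2 ^ n) X) n i ω * G₂ 1 b := by
  simp only [polarU, Matrix.vecMul, dotProduct]
  rw [← (halfEquiv n).sum_comp, Fintype.sum_prod_type, Fin.sum_univ_two, Finset.sum_mul,
    Finset.sum_mul]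
  congr 1 <;> refine Finset.sum_congr rfl fun k _ => ?_ <;>
    rw [polarMatrix_apply, bitRev_halfEquiv, kronPow_child, polarMatrix_apply, mul_assoc] <;>
    congr 1
  refine congrArg (fun j => X j ω) ?_
  rw [halfEquiv_val]
  push_cast
  simp only [Fin.val_one, Nat.cast_one]
  ring

theorem polarU_child_zero (X : ℤ → Ω → ZMod 2) (n : ℕ) (i : Fin (2 ^ n)) (ω : Ω) :
    polarU X (n + 1) (child i 0) ω = polarU X n i ω + polarU (sh (2 ^ n) X) n i ω := by
  rw [polarU_child]; simp [G₂]

theorem polarU_child_one (X : ℤ → Ω → ZMod 2) (n : ℕ) (i : Fin (2 ^ n)) (ω : Ω) :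
    polarU X (n + 1) (child i 1) ω = polarU (sh (2 ^ n) X) n i ω := by
  rw [polarU_child]; simp [G₂]

/-! ### Blocks, bits and conditioning data, described by their partitions -/

theorem block_eq_iff {α : Type*} {X : ℤ → Ω → α} {N : ℕ} {t : ℤ} {ω ω' : Ω} :
    block (sh t X) N ω = block (sh t X) N ω' ↔
      ∀ l, t < l → l ≤ t + N → X l ω = X l ω' := by
  refine ⟨fun h l h1 h2 => ?_, fun h => funext fun j => h _ (by omega) (by omega)⟩
  have := congrFun h ⟨(l - t - 1).toNat, by omega⟩
  have e : ((l - t - 1).toNat : ℤ) + 1 + t = l := by omega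
  simpa only [block, sh, e] using this

/-- The total length `K` is a separate variable so that `2 ^ (n + 1)` can be split into two blocks
of length `2 ^ n`. -/
theorem block_add_eq_iff {α : Type*} {X : ℤ → Ω → α} {N M K : ℕ} (hK : K = N + M) {t : ℤ}
    {ω ω' : Ω} :
    block (sh t X) K ω = block (sh t X) K ω' ↔
      block (sh t X) N ω = block (sh t X) N ω' ∧
      block (sh (N + t) X) M ω = block (sh (N + t) X) M ω' := by
  simp only [block_eq_iff]
  refine ⟨fun h => ⟨fun l h1 h2 => h l h1 (by omega), fun l h1 h2 => h l (by omega) (by omega)⟩,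
    fun ⟨h1, h2⟩ l h3 h4 => ?_⟩
  rcases le_or_gt l (t + N) with h | h
  · exact h1 l h3 h
  · exact h2 l (by omega) (by omega)

theorem polarU_congr {X : ℤ → Ω → ZMod 2} {n : ℕ} {t : ℤ} {ω ω' : Ω} (i : Fin (2 ^ n))
    (h : block (sh t X) (2 ^ n) ω = block (sh t X) (2 ^ n) ω') :
    polarU (sh t X) n i ω = polarU (sh t X) n i ω' := by
  rw [polarU, h, polarU]

/-- The transform is invertible. -/
theorem polarU_eq_iff {X : ℤ → Ω → ZMod 2} {n : ℕ} {t : ℤ} {ω ω' : Ω} :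
    (∀ i, polarU (sh t X) n i ω = polarU (sh t X) n i ω') ↔
      block (sh t X) (2 ^ n) ω = block (sh t X) (2 ^ n) ω' := by
  refine ⟨fun h => ?_, fun h i => polarU_congr i h⟩
  induction n generalizing t with
  | zero =>
    have : Subsingleton (Fin (2 ^ 0)) := inferInstanceAs (Subsingleton (Fin 1))
    have h0 : ∀ ω, polarU (sh t X) 0 0 ω = block (sh t X) (2 ^ 0) ω 0 := fun ω => by
      simp only [polarU, Matrix.vecMul, dotProduct]
      rw [Fintype.sum_eq_single 0 fun k hk => absurd (Subsingleton.elim k 0) hk]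
      rw [polarMatrix_apply, kronPow, Subsingleton.elim (bitRev 0 0) 0, Matrix.one_apply_eq,
        mul_one]
    funext j
    have h1 := h 0
    rw [h0, h0] at h1
    rwa [Subsingleton.elim j 0]
  | succ n ih =>
    rw [block_add_eq_iff (N := 2 ^ n) (M := 2 ^ n) (by ring)]
    -- The plus child is the bit of the second half; subtracting it from the minus child recovers
    -- the bit of the first half.
    have h2 : ∀ i, polarU (sh (2 ^ n + t) X) n i ω = polarU (sh (2 ^ n + t) X) n i ω' := by
      intro i
      have := h (child i 1)
      rwa [polarU_child_one, polarU_child_one, sh_sh] at this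
    refine ⟨ih fun i => ?_, by push_cast; exact ih h2⟩
    have := h (child i 0)
    rw [polarU_child_zero, polarU_child_zero, sh_sh, h2 i] at this
    exact add_right_cancel this

theorem polarQ_eq_iff {X : ℤ → Ω → ZMod 2} {Y : ℤ → Ω → 𝒴} {n : ℕ} {i : Fin (2 ^ n)} {ω ω' : Ω} :
    polarQ X Y n i ω = polarQ X Y n i ω' ↔
      (∀ k < i, polarU X n k ω = polarU X n k ω') ∧
        block Y (2 ^ n) ω = block Y (2 ^ n) ω' := by
  simp [polarQ, funext_iff]

theorem polarQ_congr {X : ℤ → Ω → ZMod 2} {Y : ℤ → Ω → 𝒴} {n : ℕ} {t : ℤ} {ω ω' : Ω}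
    (i : Fin (2 ^ n)) (h : block (sh t X) (2 ^ n) ω = block (sh t X) (2 ^ n) ω')
    (h' : block (sh t Y) (2 ^ n) ω = block (sh t Y) (2 ^ n) ω') :
    polarQ (sh t X) (sh t Y) n i ω = polarQ (sh t X) (sh t Y) n i ω' :=
  polarQ_eq_iff.2 ⟨fun k _ => polarU_congr k h, h'⟩

/-- The indices below `2 i` are exactly the children of all `k < i`, and the two children of `k` are
equivalent to the two bits at `k`. Comparing partitions avoids an identification of the different
alphabets and suits `ent_congr`. -/
theorem polarQ_child_zero {X : ℤ → Ω → ZMod 2} {Y : ℤ → Ω → 𝒴} {n : ℕ} {i : Fin (2 ^ n)} {t : ℤ}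
    {ω ω' : Ω} :
    polarQ (sh t X) (sh t Y) (n + 1) (child i 0) ω =
        polarQ (sh t X) (sh t Y) (n + 1) (child i 0) ω' ↔
      polarQ (sh t X) (sh t Y) n i ω = polarQ (sh t X) (sh t Y) n i ω' ∧
      polarQ (sh (2 ^ n + t) X) (sh (2 ^ n + t) Y) n i ω =
        polarQ (sh (2 ^ n + t) X) (sh (2 ^ n + t) Y) n i ω' := by
  simp only [polarQ_eq_iff]
  rw [block_add_eq_iff (N := 2 ^ n) (M := 2 ^ n) (K := 2 ^ (n + 1)) (by ring), Nat.cast_pow,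
    Nat.cast_ofNat]
  have key : (∀ k < child i 0, polarU (sh t X) (n + 1) k ω = polarU (sh t X) (n + 1) k ω') ↔
      (∀ k < i, polarU (sh t X) n k ω = polarU (sh t X) n k ω') ∧
      (∀ k < i, polarU (sh (2 ^ n + t) X) n k ω = polarU (sh (2 ^ n + t) X) n k ω') := by
    constructor
    · intro h
      have h2 : ∀ k < i, polarU (sh (2 ^ n + t) X) n k ω = polarU (sh (2 ^ n + t) X) n k ω' := by
        intro k hk
        have := h (child k 1) (by rw [Fin.lt_def] at hk ⊢; simp only [child_val]; simp; omega)
        rwa [polarU_child_one, polarU_child_one, sh_sh] at this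
      refine ⟨fun k hk => ?_, h2⟩
      have := h (child k 0) (by rw [Fin.lt_def] at hk ⊢; simp only [child_val]; simp; omega)
      rw [polarU_child_zero, polarU_child_zero, sh_sh, h2 k hk] at this
      exact add_right_cancel this
    · rintro ⟨h1, h2⟩ k hk
      obtain ⟨k, b, rfl⟩ := exists_child k
      have hk' : k < i := by rw [Fin.lt_def] at hk ⊢; simp only [child_val] at hk; simp at hk; omega
      rw [polarU_child, polarU_child, sh_sh, h1 k hk', h2 k hk']
  rw [key]
  tauto

theorem polarQ_child_one {X : ℤ → Ω → ZMod 2} {Y : ℤ → Ω → 𝒴} {n : ℕ} {i : Fin (2 ^ n)} {t : ℤ}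
    {ω ω' : Ω} :
    polarQ (sh t X) (sh t Y) (n + 1) (child i 1) ω =
        polarQ (sh t X) (sh t Y) (n + 1) (child i 1) ω' ↔
      polarU (sh t X) (n + 1) (child i 0) ω = polarU (sh t X) (n + 1) (child i 0) ω' ∧
      polarQ (sh t X) (sh t Y) (n + 1) (child i 0) ω =
        polarQ (sh t X) (sh t Y) (n + 1) (child i 0) ω' := by
  simp only [polarQ_eq_iff, ← and_assoc]
  refine and_congr_left fun _ => ⟨fun h => ⟨h _ ?_, fun k hk => h k (hk.trans ?_)⟩,
    fun ⟨h1, h2⟩ k hk => ?_⟩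
  · rw [Fin.lt_def]; simp [child_val]
  · rw [Fin.lt_def]; simp [child_val]
  · rcases eq_or_ne k (child i 0) with rfl | hne
    · exact h1
    · refine h2 k ?_
      rw [Fin.lt_def] at hk ⊢
      have := Fin.val_ne_of_ne hne
      simp only [child_val] at hk this ⊢
      simp at hk this ⊢
      omega

end Recursion

/-! ## Entropy inequalities for the polarization transform -/

section PolarEntropy

variable {Ω 𝒴 𝒮 : Type*} [MeasurableSpace Ω] [Fintype 𝒴] [Fintype 𝒮]
  {P : Measure Ω} [IsProbabilityMeasure P]
  {X : ℤ → Ω → ZMod 2} {Y : ℤ → Ω → 𝒴} {S : ℤ → Ω → 𝒮}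

theorem ent_pair_le {α β : Type*} [Fintype α] [Fintype β] {U : Ω → α} {Q : Ω → β}
    (hU : Discr U) (hQ : Discr Q) : ent P (fun ω => (U ω, Q ω)) ≤ ent P U + ent P Q := by
  have hk : Discr (fun _ : Ω => ()) := discr_of_singleton fun a => by simp
  have h2 := ent_submodular (P := P) hU hQ hk
  have e1 : ent P (fun ω => (U ω, Q ω, ())) = ent P (fun ω => (U ω, Q ω)) :=
    ent_congr (hU.prodMk (hQ.prodMk hk)) (by simp)
  have e2 : ent P (fun ω => (U ω, ())) = ent P U := ent_congr (hU.prodMk hk) (by simp)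
  have e3 : ent P (fun ω => (Q ω, ())) = ent P Q := ent_congr (hQ.prodMk hk) (by simp)
  have h3 := ent_nonneg (P := P) (fun _ : Ω => ())
  linarith

theorem condEntropy_mem_Icc {β : Type*} [Fintype β] {U : Ω → ZMod 2} {Q : Ω → β} (hU : Discr U)
    (hQ : Discr Q) : condEntropy P U Q ∈ Set.Icc (0 : ℝ) 1 := by
  have hlog := Real.log_pos one_lt_two
  have h0 := condEntropy_mul_log_two (P := P) hU hQ
  have h1 := ent_mono (P := P) (hU.prodMk hQ) (g := Q) (fun ω ω' h => (Prod.ext_iff.1 h).2)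
  have h2 := ent_pair_le (P := P) hU hQ
  have h4 := ent_le_log_card (P := P) hU
  rw [ZMod.card, Nat.cast_ofNat] at h4
  constructor
  · by_contra! hneg
    nlinarith
  · by_contra! hgt
    nlinarith

omit [Fintype 𝒮] [IsProbabilityMeasure P] in
theorem IsFAIM.discr_blocks (h : IsFAIM P X Y S) (t : ℤ) (N : ℕ) :
    Discr (fun ω => (block (sh t X) N ω, block (sh t Y) N ω)) :=
  (h.discr_block_X t N).prodMk (h.discr_block_Y t N)

omit [Fintype 𝒴] [Fintype 𝒮] [IsProbabilityMeasure P] in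
theorem IsFAIM.discr_polarU (h : IsFAIM P X Y S) (t : ℤ) (n : ℕ) (i : Fin (2 ^ n)) :
    Discr (polarU (sh t X) n i) :=
  (h.discr_block_X t (2 ^ n)).comp fun x => Matrix.vecMul x (polarMatrix n) i

omit [Fintype 𝒮] [IsProbabilityMeasure P] in
theorem IsFAIM.discr_polarQ (h : IsFAIM P X Y S) (t : ℤ) (n : ℕ) (i : Fin (2 ^ n)) :
    Discr (polarQ (sh t X) (sh t Y) n i) :=
  (h.discr_blocks t (2 ^ n)).comp fun x =>
    ((fun k : {k : Fin (2 ^ n) // k < i} => Matrix.vecMul x.1 (polarMatrix n) k), x.2)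

theorem IsFAIM.ent_blockWin (h : IsFAIM P X Y S) {α : Type*} [Fintype α] (t : ℤ) (N : ℕ)
    (e : (Fin N → ZMod 2) × (Fin N → 𝒴) × 𝒮 × 𝒮 → α) :
    ent P (fun ω => e (blockWin X Y S t N ω)) = ent P (fun ω => e (blockWin X Y S 0 N ω)) :=
  ent_eq_of_law_eq fun a => h.law_blockWin t N e a

/-- Stationarity of the boundary-state-informed entropies. -/
theorem IsFAIM.condEntropy_sh (h : IsFAIM P X Y S) (t : ℤ) (n : ℕ) (i : Fin (2 ^ n)) :
    condEntropy P (polarU (sh t X) n i)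
      (fun ω => (polarQ (sh t X) (sh t Y) n i ω, S (t + 2 ^ n) ω, S t ω)) =
    bsiIndexEntropy P X Y S n i := by
  have hlog := Real.log_pos one_lt_two
  have hQ : ∀ t : ℤ, Discr (fun ω =>
      (polarQ (sh t X) (sh t Y) n i ω, S (t + (2 ^ n : ℕ)) ω, S t ω)) := fun t =>
    (h.discr_polarQ t n i).prodMk ((h.discr_S _).prodMk (h.discr_S _))
  have e : ∀ t : ℤ, condEntropy P (polarU (sh t X) n i)
      (fun ω => (polarQ (sh t X) (sh t Y) n i ω, S (t + (2 ^ n : ℕ)) ω, S t ω)) * Real.log 2 =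
    condEntropy P (polarU (sh 0 X) n i)
      (fun ω => (polarQ (sh 0 X) (sh 0 Y) n i ω, S (0 + (2 ^ n : ℕ)) ω, S 0 ω)) * Real.log 2 := by
    intro t
    rw [condEntropy_mul_log_two (h.discr_polarU t n i) (hQ t),
      condEntropy_mul_log_two (h.discr_polarU 0 n i) (hQ 0)]
    congr 1
    · exact h.ent_blockWin t (2 ^ n) fun x => (Matrix.vecMul x.1 (polarMatrix n) i,
        ((fun k : {k : Fin (2 ^ n) // k < i} => Matrix.vecMul x.1 (polarMatrix n) k), x.2.1),
        x.2.2.1, x.2.2.2)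
    · exact h.ent_blockWin t (2 ^ n) fun x =>
        (((fun k : {k : Fin (2 ^ n) // k < i} => Matrix.vecMul x.1 (polarMatrix n) k), x.2.1),
        x.2.2.1, x.2.2.2)
  have := mul_right_cancel₀ hlog.ne' (e t)
  rw [sh_zero, sh_zero, zero_add] at this
  rw [bsiIndexEntropy, ← this]
  push_cast
  rfl

theorem IsFAIM.ent_sub_ent (h : IsFAIM P X Y S) (t : ℤ) (n : ℕ) (i : Fin (2 ^ n)) :
    ent P (fun ω => (polarU (sh t X) n i ω, polarQ (sh t X) (sh t Y) n i ω,
      S (t + 2 ^ n) ω, S t ω)) -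
    ent P (fun ω => (polarQ (sh t X) (sh t Y) n i ω, S (t + 2 ^ n) ω, S t ω)) =
    bsiIndexEntropy P X Y S n i * Real.log 2 := by
  rw [← h.condEntropy_sh t, condEntropy_mul_log_two (h.discr_polarU t n i)
    ((h.discr_polarQ t n i).prodMk ((h.discr_S _).prodMk (h.discr_S _)))]

omit [Fintype 𝒮] in
theorem IsFAIM.indexEntropy_mul (h : IsFAIM P X Y S) (n : ℕ) (i : Fin (2 ^ n)) :
    indexEntropy P X Y n i * Real.log 2 =
      ent P (fun ω => (polarU (sh 0 X) n i ω, polarQ (sh 0 X) (sh 0 Y) n i ω)) -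
        ent P (polarQ (sh 0 X) (sh 0 Y) n i) := by
  have := condEntropy_mul_log_two (P := P) (h.discr_polarU 0 n i) (h.discr_polarQ 0 n i)
  rw [← this, sh_zero, sh_zero, indexEntropy]

omit [Fintype 𝒮] in
theorem IsFAIM.indexEntropy_mem_Icc (h : IsFAIM P X Y S) (n : ℕ) (i : Fin (2 ^ n)) :
    indexEntropy P X Y n i ∈ Set.Icc (0 : ℝ) 1 := by
  have := condEntropy_mem_Icc (P := P) (h.discr_polarU 0 n i) (h.discr_polarQ 0 n i)
  rwa [sh_zero, sh_zero] at this

theorem IsFAIM.bsiIndexEntropy_mem_Icc (h : IsFAIM P X Y S) (n : ℕ) (i : Fin (2 ^ n)) :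
    bsiIndexEntropy P X Y S n i ∈ Set.Icc (0 : ℝ) 1 := by
  rw [← h.condEntropy_sh 0]
  exact condEntropy_mem_Icc (h.discr_polarU 0 n i)
    ((h.discr_polarQ 0 n i).prodMk ((h.discr_S _).prodMk (h.discr_S _)))

theorem IsFAIM.bsiIndexEntropy_le (h : IsFAIM P X Y S) (n : ℕ) (i : Fin (2 ^ n)) :
    bsiIndexEntropy P X Y S n i ≤ indexEntropy P X Y n i := by
  have hlog := Real.log_pos one_lt_two
  have dU := h.discr_polarU 0 n i
  have dQ := h.discr_polarQ 0 n i
  have dS := (h.discr_S (0 + 2 ^ n)).prodMk (h.discr_S 0)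
  have h1 := h.ent_sub_ent 0 n i
  have h2 := h.indexEntropy_mul n i
  have h3 := ent_submodular (P := P) dU dS dQ
  have e1 : ent P (fun ω => (polarU (sh 0 X) n i ω, (S (0 + 2 ^ n) ω, S 0 ω),
      polarQ (sh 0 X) (sh 0 Y) n i ω)) = ent P (fun ω => (polarU (sh 0 X) n i ω,
      polarQ (sh 0 X) (sh 0 Y) n i ω, S (0 + 2 ^ n) ω, S 0 ω)) :=
    ent_congr (dU.prodMk (dS.prodMk dQ)) fun ω ω' => by simp only [Prod.mk.injEq]; tauto
  have e2 : ent P (fun ω => ((S (0 + 2 ^ n) ω, S 0 ω), polarQ (sh 0 X) (sh 0 Y) n i ω)) =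
      ent P (fun ω => (polarQ (sh 0 X) (sh 0 Y) n i ω, S (0 + 2 ^ n) ω, S 0 ω)) :=
    ent_congr (dS.prodMk dQ) fun ω ω' => by simp only [Prod.mk.injEq]; tauto
  refine le_of_mul_le_mul_right ?_ hlog
  rw [← h1, h2]
  linarith

/-- The submartingale inequality for the boundary-state-informed entropies. -/
theorem IsFAIM.two_mul_bsiIndexEntropy_le (h : IsFAIM P X Y S) (n : ℕ) (i : Fin (2 ^ n)) :
    2 * bsiIndexEntropy P X Y S n i ≤
      bsiIndexEntropy P X Y S (n + 1) (child i 0) +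
        bsiIndexEntropy P X Y S (n + 1) (child i 1) := by
  have hlog := Real.log_pos one_lt_two
  set T : ℤ := 2 ^ n with hT
  have hT0 : 0 < T := by positivity
  have dV := h.discr_polarU 0 n i
  have dV' := h.discr_polarU T n i
  have dQ := h.discr_polarQ 0 n i
  have dQ' := h.discr_polarQ T n i
  have dS := h.discr_S
  have c0 := h.ent_sub_ent 0 (n + 1) (child i 0)
  have c1 := h.ent_sub_ent 0 (n + 1) (child i 1)
  have hTT : (0 : ℤ) + 2 ^ (n + 1) = T + T := by rw [hT]; ring
  rw [hTT] at c0 c1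
  have dU0 := h.discr_polarU 0 (n + 1) (child i 0)
  have dU1 := h.discr_polarU 0 (n + 1) (child i 1)
  have dQ0 := h.discr_polarQ 0 (n + 1) (child i 0)
  have dQ1 := h.discr_polarQ 0 (n + 1) (child i 1)
  have dSS := (dS (T + T)).prodMk (dS 0)
  have q0 : ∀ ω ω', polarQ (sh 0 X) (sh 0 Y) (n + 1) (child i 0) ω =
      polarQ (sh 0 X) (sh 0 Y) (n + 1) (child i 0) ω' ↔ _ := fun ω ω' => polarQ_child_zero
  have q1 : ∀ ω ω', polarQ (sh 0 X) (sh 0 Y) (n + 1) (child i 1) ω =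
      polarQ (sh 0 X) (sh 0 Y) (n + 1) (child i 1) ω' ↔ _ := fun ω ω' => polarQ_child_one
  have u1 : ∀ ω, polarU (sh 0 X) (n + 1) (child i 1) ω = polarU (sh T X) n i ω := fun ω => by
    rw [polarU_child_one, sh_sh, add_zero]
  have u0 : ∀ ω, polarU (sh 0 X) (n + 1) (child i 0) ω =
      polarU (sh 0 X) n i ω + polarU (sh T X) n i ω := fun ω => by
    rw [polarU_child_zero, sh_sh, add_zero]
  rw [add_zero, ← hT] at q0
  -- The joint entropy for child `0` is the conditioning entropy for child `1`, so the two
  -- differences telescope.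
  have e1 : ent P (fun ω => (polarU (sh 0 X) (n + 1) (child i 0) ω,
      polarQ (sh 0 X) (sh 0 Y) (n + 1) (child i 0) ω, S (T + T) ω, S 0 ω)) =
      ent P (fun ω => (polarQ (sh 0 X) (sh 0 Y) (n + 1) (child i 1) ω, S (T + T) ω, S 0 ω)) :=
    ent_congr (dU0.prodMk (dQ0.prodMk dSS)) fun ω ω' => by
      simp only [Prod.mk.injEq, q1]; tauto
  have e2 : ent P (fun ω => (polarU (sh 0 X) (n + 1) (child i 1) ω,
      polarQ (sh 0 X) (sh 0 Y) (n + 1) (child i 1) ω, S (T + T) ω, S 0 ω)) =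
      ent P (fun ω => ((polarU (sh 0 X) n i ω, polarU (sh T X) n i ω),
        polarQ (sh 0 X) (sh 0 Y) n i ω, polarQ (sh T X) (sh T Y) n i ω, S (T + T) ω, S 0 ω)) :=
    ent_congr (dU1.prodMk (dQ1.prodMk dSS)) fun ω ω' => by
      simp only [Prod.mk.injEq, q1, q0, u1, u0]
      constructor
      · rintro ⟨a1, ⟨a2, a3, a4⟩, a5⟩
        rw [a1] at a2
        exact ⟨⟨add_right_cancel a2, a1⟩, a3, a4, a5⟩
      · rintro ⟨⟨a1, a2⟩, a3, a4, a5⟩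
        exact ⟨a2, ⟨by rw [a1, a2], a3, a4⟩, a5⟩
  have e3 : ent P (fun ω => (polarQ (sh 0 X) (sh 0 Y) (n + 1) (child i 0) ω,
      S (T + T) ω, S 0 ω)) = ent P (fun ω => (polarQ (sh 0 X) (sh 0 Y) n i ω,
      polarQ (sh T X) (sh T Y) n i ω, S (T + T) ω, S 0 ω)) :=
    ent_congr (dQ0.prodMk dSS) fun ω ω' => by
      simp only [Prod.mk.injEq, q0]; tauto
  -- Additional conditioning on the middle state `S T` lowers the entropy of the pair of bits.
  have sub := ent_submodular (P := P) (dV.prodMk dV') (dS T)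
    (dQ.prodMk (dQ'.prodMk ((dS (T + T)).prodMk (dS 0))))
  have hbX : ∀ ω ω', (∀ l, T < l → l ≤ T + (2 ^ n : ℕ) →
      X l ω = X l ω' ∧ Y l ω = Y l ω' ∧ S l ω = S l ω') →
      block (sh T X) (2 ^ n) ω = block (sh T X) (2 ^ n) ω' ∧
      block (sh T Y) (2 ^ n) ω = block (sh T Y) (2 ^ n) ω' := fun ω ω' hl =>
    ⟨block_eq_iff.2 fun l h1 h2 => (hl l h1 h2).1, block_eq_iff.2 fun l h1 h2 => (hl l h1 h2).2.1⟩
  have hbX0 : ∀ ω ω', (∀ l, T - (2 ^ n : ℕ) < l → l ≤ T →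
      X l ω = X l ω' ∧ Y l ω = Y l ω' ∧ S (l - 1) ω = S (l - 1) ω') →
      block (sh 0 X) (2 ^ n) ω = block (sh 0 X) (2 ^ n) ω' ∧
      block (sh 0 Y) (2 ^ n) ω = block (sh 0 Y) (2 ^ n) ω' ∧ S 0 ω = S 0 ω' := fun ω ω' hl => by
    have hc : ((2 ^ n : ℕ) : ℤ) = T := by push_cast; rfl
    rw [hc] at hl
    exact ⟨block_eq_iff.2 fun l h1 h2 => (hl l (by omega) (by omega)).1,
      block_eq_iff.2 fun l h1 h2 => (hl l (by omega) (by omega)).2.1,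
      by simpa using (hl 1 (by omega) (by omega)).2.2⟩
  -- Given `S T` the halves separate, so the entropy of the pair is a sum of two block terms, which
  -- agree by stationarity.
  have ci : CondIndepGiven P
      (fun ω => (polarU (sh 0 X) n i ω, polarQ (sh 0 X) (sh 0 Y) n i ω, S 0 ω))
      (fun ω => (polarU (sh T X) n i ω, polarQ (sh T X) (sh T Y) n i ω, S (T + T) ω)) (S T) := by
    refine h.condIndep T (2 ^ n) (fun ω ω' _ hl => ?_) (fun ω ω' _ hl => ?_)
    · obtain ⟨b1, b2, b3⟩ := hbX0 ω ω' hl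
      simp only [polarU_congr i b1, polarQ_congr i b1 b2, b3]
    · obtain ⟨b1, b2⟩ := hbX ω ω' hl
      have b3 := (hl (T + T) (by omega) (by push_cast; rfl)).2.2
      simp only [polarU_congr i b1, polarQ_congr i b1 b2, b3]
  have ci' := ci.mono (f' := fun ω => (polarQ (sh 0 X) (sh 0 Y) n i ω, S 0 ω))
    (g' := fun ω => (polarQ (sh T X) (sh T Y) n i ω, S (T + T) ω))
    (fun ω ω' _ hp => (Prod.ext_iff.1 hp).2) (fun ω ω' _ hp => (Prod.ext_iff.1 hp).2)
  have i1 := ci.ent_add_ent (dV.prodMk (dQ.prodMk (dS 0)))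
    (dV'.prodMk (dQ'.prodMk (dS (T + T)))) (dS T)
  have i2 := ci'.ent_add_ent (dQ.prodMk (dS 0)) (dQ'.prodMk (dS (T + T))) (dS T)
  have b0 := h.ent_sub_ent 0 n i
  have b1 := h.ent_sub_ent T n i
  rw [zero_add] at b0
  have f1 : ent P (fun ω => ((polarU (sh 0 X) n i ω, polarU (sh T X) n i ω), S T ω,
      polarQ (sh 0 X) (sh 0 Y) n i ω, polarQ (sh T X) (sh T Y) n i ω, S (T + T) ω, S 0 ω)) =
      ent P (fun ω => ((polarU (sh 0 X) n i ω, polarQ (sh 0 X) (sh 0 Y) n i ω, S 0 ω),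
        (polarU (sh T X) n i ω, polarQ (sh T X) (sh T Y) n i ω, S (T + T) ω), S T ω)) :=
    ent_congr ((dV.prodMk dV').prodMk ((dS T).prodMk
      (dQ.prodMk (dQ'.prodMk ((dS (T + T)).prodMk (dS 0)))))) fun ω ω' => by
      simp only [Prod.mk.injEq]; tauto
  have f2 : ent P (fun ω => (S T ω,
      polarQ (sh 0 X) (sh 0 Y) n i ω, polarQ (sh T X) (sh T Y) n i ω, S (T + T) ω, S 0 ω)) =
      ent P (fun ω => ((polarQ (sh 0 X) (sh 0 Y) n i ω, S 0 ω),
        (polarQ (sh T X) (sh T Y) n i ω, S (T + T) ω), S T ω)) :=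
    ent_congr ((dS T).prodMk
      (dQ.prodMk (dQ'.prodMk ((dS (T + T)).prodMk (dS 0))))) fun ω ω' => by
      simp only [Prod.mk.injEq]; tauto
  have f3 : ent P (fun ω => ((polarU (sh 0 X) n i ω, polarQ (sh 0 X) (sh 0 Y) n i ω, S 0 ω),
      S T ω)) = ent P (fun ω => (polarU (sh 0 X) n i ω, polarQ (sh 0 X) (sh 0 Y) n i ω,
        S T ω, S 0 ω)) :=
    ent_congr ((dV.prodMk (dQ.prodMk (dS 0))).prodMk (dS T)) fun ω ω' => by
      simp only [Prod.mk.injEq]; tauto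
  have f4 : ent P (fun ω => ((polarQ (sh 0 X) (sh 0 Y) n i ω, S 0 ω), S T ω)) =
      ent P (fun ω => (polarQ (sh 0 X) (sh 0 Y) n i ω, S T ω, S 0 ω)) :=
    ent_congr ((dQ.prodMk (dS 0)).prodMk (dS T)) fun ω ω' => by
      simp only [Prod.mk.injEq]; tauto
  have f5 : ent P (fun ω => ((polarU (sh T X) n i ω, polarQ (sh T X) (sh T Y) n i ω,
      S (T + T) ω), S T ω)) = ent P (fun ω => (polarU (sh T X) n i ω,
        polarQ (sh T X) (sh T Y) n i ω, S (T + T) ω, S T ω)) :=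
    ent_congr ((dV'.prodMk (dQ'.prodMk (dS (T + T)))).prodMk (dS T)) fun ω ω' => by
      simp only [Prod.mk.injEq]; tauto
  have f6 : ent P (fun ω => ((polarQ (sh T X) (sh T Y) n i ω, S (T + T) ω), S T ω)) =
      ent P (fun ω => (polarQ (sh T X) (sh T Y) n i ω, S (T + T) ω, S T ω)) :=
    ent_congr ((dQ'.prodMk (dS (T + T))).prodMk (dS T)) fun ω ω' => by
      simp only [Prod.mk.injEq]; tauto
  refine le_of_mul_le_mul_right ?_ hlog
  linarith

/-- The chain rule, telescoped. -/
theorem sum_ent_sub_ent {ρ : Type*} [Fintype ρ] {N : ℕ} {U : Fin N → Ω → ZMod 2} {R : Ω → ρ}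
    (hU : ∀ i, Discr (U i)) (hR : Discr R) :
    ∑ i : Fin N, (ent P (fun ω => (U i ω, (fun k : {k : Fin N // k < i} => U k ω), R ω)) -
      ent P (fun ω => ((fun k : {k : Fin N // k < i} => U k ω), R ω))) =
    ent P (fun ω => ((fun k => U k ω), R ω)) - ent P R := by
  -- Bits with index at least `m` are replaced by `0`, so that all prefixes have the same type and
  -- the sum telescopes.
  let T : ℕ → ℝ := fun m => ent P (fun ω => ((fun k : Fin N => if k.val < m then U k ω else 0),
    R ω))
  have hd : ∀ m, Discr (fun ω => ((fun k : Fin N => if k.val < m then U k ω else 0), R ω)) :=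
    fun m => ((Discr.pi hU).comp fun x (k : Fin N) => if k.val < m then x k else 0).prodMk hR
  have key : ∀ m (ω ω' : Ω), ((fun k : Fin N => if k.val < m then U k ω else 0) =
      fun k => if k.val < m then U k ω' else 0) ↔ ∀ k : Fin N, k.val < m → U k ω = U k ω' := by
    intro m ω ω'
    rw [funext_iff]
    refine forall_congr' fun k => ?_
    by_cases hk : k.val < m <;> simp [hk]
  have key' : ∀ (i : Fin N) (ω ω' : Ω), ((fun k : {k : Fin N // k < i} => U k ω) =
      fun k : {k : Fin N // k < i} => U k ω') ↔ ∀ k : Fin N, k.val < i → U k ω = U k ω' := by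
    intro i ω ω'
    simp only [funext_iff, Subtype.forall]
    exact Iff.rfl
  have h1 : ∀ i : Fin N, ent P (fun ω => (U i ω, (fun k : {k : Fin N // k < i} => U k ω), R ω)) =
      T (i + 1) := by
    intro i
    refine (ent_congr (hd _) fun ω ω' => ?_).symm
    simp only [Prod.mk.injEq]
    rw [key, key', ← and_assoc]
    refine and_congr_left fun _ => ⟨fun h => ⟨h i (by omega), fun k hk => h k (by omega)⟩,
      fun ⟨h1, h2⟩ k hk => ?_⟩
    rcases eq_or_ne k i with rfl | hne
    · exact h1
    · exact h2 k (by have := Fin.val_ne_of_ne hne; omega)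
  have h2 : ∀ i : Fin N, ent P (fun ω => ((fun k : {k : Fin N // k < i} => U k ω), R ω)) = T i := by
    intro i
    refine (ent_congr (hd _) fun ω ω' => ?_).symm
    simp only [Prod.mk.injEq]
    rw [key, key']
  have h3 : T N = ent P (fun ω => ((fun k => U k ω), R ω)) := by
    simp [T]
  have h4 : T 0 = ent P R := by
    refine ent_congr (hd 0) fun ω ω' => ?_
    simp
  simp only [h1, h2]
  rw [← h3, ← h4, ← Finset.sum_range_sub, Finset.sum_range]

/-! ### Totals over all indices and the entropy rate -/

omit [Fintype 𝒮] in
theorem IsFAIM.sum_indexEntropy_mul (h : IsFAIM P X Y S) (n : ℕ) :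
    (∑ i, indexEntropy P X Y n i) * Real.log 2 =
      ent P (fun ω => ((fun i => polarU (sh 0 X) n i ω), block (sh 0 Y) (2 ^ n) ω)) -
        ent P (block (sh 0 Y) (2 ^ n)) := by
  rw [← sum_ent_sub_ent (fun i => h.discr_polarU 0 n i) (h.discr_block_Y 0 (2 ^ n)),
    Finset.sum_mul]
  exact Finset.sum_congr rfl fun i _ => h.indexEntropy_mul n i

theorem IsFAIM.sum_bsiIndexEntropy_mul (h : IsFAIM P X Y S) (n : ℕ) :
    (∑ i, bsiIndexEntropy P X Y S n i) * Real.log 2 =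
      ent P (fun ω => ((fun i => polarU (sh 0 X) n i ω),
        block (sh 0 Y) (2 ^ n) ω, S (0 + 2 ^ n) ω, S 0 ω)) -
      ent P (fun ω => (block (sh 0 Y) (2 ^ n) ω, S (0 + 2 ^ n) ω, S 0 ω)) := by
  have dS := (h.discr_S (0 + 2 ^ n)).prodMk (h.discr_S 0)
  have dR := (h.discr_block_Y 0 (2 ^ n)).prodMk dS
  rw [← sum_ent_sub_ent (fun i => h.discr_polarU 0 n i) dR, Finset.sum_mul]
  refine Finset.sum_congr rfl fun i _ => ?_
  rw [← h.ent_sub_ent 0 n i]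
  congr 1
  · refine ent_congr ((h.discr_polarU 0 n i).prodMk ((h.discr_polarQ 0 n i).prodMk dS))
      fun ω ω' => ?_
    simp only [polarQ, Prod.mk.injEq, and_assoc]
  · refine ent_congr ((h.discr_polarQ 0 n i).prodMk dS) fun ω ω' => ?_
    simp only [polarQ, Prod.mk.injEq, and_assoc]

omit [Fintype 𝒮] in
-- Besides the chain rule this uses invertibility: by `polarU_eq_iff`, the bits and the block
-- generate the same partition.
theorem IsFAIM.sum_indexEntropy (h : IsFAIM P X Y S) (n : ℕ) :
    ∑ i, indexEntropy P X Y n i = condEntropy P (block X (2 ^ n)) (block Y (2 ^ n)) := by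
  refine mul_right_cancel₀ (Real.log_pos one_lt_two).ne' ?_
  have dX := h.discr_block_X 0 (2 ^ n)
  have dY := h.discr_block_Y 0 (2 ^ n)
  have hc := condEntropy_mul_log_two (P := P) dX dY
  have e : ent P (fun ω => (block (sh 0 X) (2 ^ n) ω, block (sh 0 Y) (2 ^ n) ω)) =
      ent P (fun ω => ((fun i => polarU (sh 0 X) n i ω), block (sh 0 Y) (2 ^ n) ω)) := by
    refine ent_congr (dX.prodMk dY) fun ω ω' => ?_
    simp only [Prod.mk.injEq]
    rw [← polarU_eq_iff, funext_iff (f := fun i => polarU (sh 0 X) n i ω)]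
  rw [h.sum_indexEntropy_mul, ← e, ← hc, sh_zero, sh_zero]

/-- By the chain rule the total gap is a difference of two block conditional entropies, which is at
most the entropy of the pair of boundary states. The bound does not depend on `n`. -/
theorem IsFAIM.sum_sub_le (h : IsFAIM P X Y S) (n : ℕ) :
    ∑ i, (indexEntropy P X Y n i - bsiIndexEntropy P X Y S n i) ≤
      Real.log (Fintype.card (𝒮 × 𝒮)) / Real.log 2 := by
  rw [le_div_iff₀ (Real.log_pos one_lt_two), Finset.sum_sub_distrib, sub_mul,
    h.sum_indexEntropy_mul, h.sum_bsiIndexEntropy_mul]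
  have dS := (h.discr_S (0 + 2 ^ n)).prodMk (h.discr_S 0)
  have dY := h.discr_block_Y 0 (2 ^ n)
  have dU := Discr.pi fun i => h.discr_polarU 0 n i
  have h1 := ent_mono (P := P) (dU.prodMk (dY.prodMk dS))
    (g := fun ω => ((fun i => polarU (sh 0 X) n i ω), block (sh 0 Y) (2 ^ n) ω))
    (fun ω ω' hw => by simp only [Prod.mk.injEq] at hw ⊢; tauto)
  have h2 := ent_pair_le (P := P) dY dS
  have h3 := ent_le_log_card (P := P) dS
  linarith

theorem ent_sub_le_of_cond {α β γ : Type*} [Fintype α] [Fintype β] [Fintype γ] {f : Ω → α}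
    {g : Ω → β} {k : Ω → γ} (hf : Discr f) (hg : Discr g) (hk : Discr k) :
    ent P (fun ω => (f ω, g ω, k ω)) - ent P (fun ω => (g ω, k ω)) ≤
      ent P (fun ω => (f ω, k ω)) - ent P k := by
  linarith [ent_submodular (P := P) hf hg hk]

theorem IsFAIM.condEntropy_block_sh (h : IsFAIM P X Y S) (t : ℤ) (N : ℕ) :
    ent P (fun ω => (block (sh t X) N ω, block (sh t Y) N ω)) - ent P (block (sh t Y) N) =
      condEntropy P (block X N) (block Y N) * Real.log 2 := by
  have e1 : ent P (fun ω => (block (sh t X) N ω, block (sh t Y) N ω)) =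
      ent P (fun ω => (block (sh 0 X) N ω, block (sh 0 Y) N ω)) :=
    h.ent_blockWin t N fun x => (x.1, x.2.1)
  have e2 : ent P (block (sh t Y) N) = ent P (block (sh 0 Y) N) :=
    h.ent_blockWin t N fun x => x.2.1
  rw [e1, e2, ← condEntropy_mul_log_two (h.discr_block_X 0 N) (h.discr_block_Y 0 N), sh_zero,
    sh_zero]

/-- Given both observation blocks, the entropy of the two input blocks is at most the sum of their
entropies. Forgetting the observations of the other block raises each term, and stationarity moves
the second block to the origin. -/
theorem IsFAIM.subadditive (h : IsFAIM P X Y S) :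
    Subadditive fun N : ℕ => condEntropy P (block X N) (block Y N) := by
  intro N M
  have hlog := Real.log_pos one_lt_two
  have dX := h.discr_block_X 0 N
  have dY := h.discr_block_Y 0 N
  have dX' := h.discr_block_X (N + 0) M
  have dY' := h.discr_block_Y (N + 0) M
  have c := h.condEntropy_block_sh 0 (N + M)
  have e1 : ent P (fun ω => (block (sh 0 X) (N + M) ω, block (sh 0 Y) (N + M) ω)) =
      ent P (fun ω => (block (sh 0 X) N ω, block (sh (N + 0) X) M ω, block (sh 0 Y) N ω,
        block (sh (N + 0) Y) M ω)) :=
    ent_congr ((h.discr_block_X 0 _).prodMk (h.discr_block_Y 0 _)) fun ω ω' => by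
      simp only [Prod.mk.injEq, block_add_eq_iff (K := N + M) rfl, and_assoc]
  have e2 : ent P (block (sh 0 Y) (N + M)) =
      ent P (fun ω => (block (sh 0 Y) N ω, block (sh (N + 0) Y) M ω)) :=
    ent_congr (h.discr_block_Y 0 _) fun ω ω' => by
      simp only [Prod.mk.injEq, block_add_eq_iff (K := N + M) rfl]
  have h1 := ent_submodular (P := P) dX dX' (dY.prodMk dY')
  have h2 := ent_sub_le_of_cond (P := P) dX dY' dY
  have h3 := ent_sub_le_of_cond (P := P) dX' dY dY'
  have e3 : ent P (fun ω => (block (sh 0 X) N ω, block (sh (N + 0) Y) M ω,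
      block (sh 0 Y) N ω)) = ent P (fun ω => (block (sh 0 X) N ω, block (sh 0 Y) N ω,
        block (sh (N + 0) Y) M ω)) :=
    ent_congr (dX.prodMk (dY'.prodMk dY)) fun ω ω' => by simp only [Prod.mk.injEq]; tauto
  have e4 : ent P (fun ω => (block (sh (N + 0) Y) M ω, block (sh 0 Y) N ω)) =
      ent P (fun ω => (block (sh 0 Y) N ω, block (sh (N + 0) Y) M ω)) :=
    ent_congr (dY'.prodMk dY) fun ω ω' => by simp only [Prod.mk.injEq]; tauto
  have c1 := h.condEntropy_block_sh 0 N
  have c2 := h.condEntropy_block_sh (N + 0) M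
  refine le_of_mul_le_mul_right ?_ hlog
  linarith

/-- The entropy rate exists. -/
theorem IsFAIM.tendsto_condEntropyRate (h : IsFAIM P X Y S) :
    Tendsto (fun N : ℕ => condEntropy P (block X N) (block Y N) / (N : ℝ)) atTop
      (𝓝 (condEntropyRate P X Y)) := by
  have hlog := Real.log_pos one_lt_two
  have hnn : ∀ N, 0 ≤ condEntropy P (block X N) (block Y N) := by
    intro N
    have c := h.condEntropy_block_sh 0 N
    have := ent_mono (P := P) (h.discr_blocks 0 N) (g := block (sh 0 Y) N)
      (fun ω ω' hw => (Prod.ext_iff.1 hw).2)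
    by_contra! hneg
    nlinarith
  refine tendsto_nhds_limUnder ⟨_, h.subadditive.tendsto_lim ⟨0, ?_⟩⟩
  rintro _ ⟨N, rfl⟩
  exact div_nonneg (hnn N) (Nat.cast_nonneg N)

end PolarEntropy

/-! ## Two minus steps increase the entropy -/

section MinusMinus

variable {Ω 𝒴 𝒮 : Type*} [MeasurableSpace Ω] [Fintype 𝒴] [Fintype 𝒮]
  {P : Measure Ω} [IsProbabilityMeasure P]
  {X : ℤ → Ω → ZMod 2} {Y : ℤ → Ω → 𝒴} {S : ℤ → Ω → 𝒮}

/-- Two applications of the Markov property, for entropies: `a` precedes `s`, which precedes `m`,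
which precedes `t`, which precedes `d`. -/
theorem ent_markov_chain {α σ μ τ δ : Type*} [Fintype α] [Fintype σ] [Fintype μ] [Fintype τ]
    [Fintype δ] {a : Ω → α} {s : Ω → σ} {m : Ω → μ} {t : Ω → τ} {d : Ω → δ} (ha : Discr a)
    (hs : Discr s) (hm : Discr m) (ht : Discr t) (hd : Discr d)
    (h1 : CondIndepGiven P a (fun ω => (m ω, t ω, d ω)) s)
    (h2 : CondIndepGiven P (fun ω => (s ω, m ω)) d t) :
    ent P (fun ω => (a ω, s ω, m ω, t ω, d ω)) = ent P (fun ω => (a ω, s ω)) - ent P s +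
      ent P (fun ω => (s ω, m ω, t ω)) + (ent P (fun ω => (d ω, t ω)) - ent P t) := by
  have i1 := h1.ent_add_ent ha (hm.prodMk (ht.prodMk hd)) hs
  have i2 := h2.ent_add_ent (hs.prodMk hm) hd ht
  have e1 : ent P (fun ω => (a ω, s ω, m ω, t ω, d ω)) =
      ent P (fun ω => (a ω, (m ω, t ω, d ω), s ω)) :=
    ent_congr (ha.prodMk (hs.prodMk (hm.prodMk (ht.prodMk hd)))) fun ω ω' => by
      simp only [Prod.mk.injEq]; tauto
  have e2 : ent P (fun ω => ((m ω, t ω, d ω), s ω)) = ent P (fun ω => ((s ω, m ω), d ω, t ω)) :=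
    ent_congr ((hm.prodMk (ht.prodMk hd)).prodMk hs) fun ω ω' => by
      simp only [Prod.mk.injEq]; tauto
  have e3 : ent P (fun ω => ((s ω, m ω), t ω)) = ent P (fun ω => (s ω, m ω, t ω)) :=
    ent_congr ((hs.prodMk hm).prodMk ht) fun ω ω' => by
      simp only [Prod.mk.injEq]; tauto
  linarith

omit [IsProbabilityMeasure P] in
/-- Two applications of the Markov property, for probability mass functions. -/
theorem law_markov_chain {α σ τ δ : Type*} {a : Ω → α} {s : Ω → σ} {t : Ω → τ} {d : Ω → δ}
    (h1 : CondIndepGiven P a (fun ω => (t ω, d ω)) s)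
    (h2 : CondIndepGiven P s d t) (x : α) (y : σ) (z : τ) (w : δ) :
    law P (fun ω => ((a ω, s ω), (d ω, t ω))) ((x, y), (w, z)) * law P s y * law P t z =
      law P (fun ω => (a ω, s ω)) (x, y) * law P (fun ω => (s ω, t ω)) (y, z) *
        law P (fun ω => (d ω, t ω)) (w, z) := by
  have i1 := h1.law_mul_law x (z, w) y
  have i2 := h2.law_mul_law y w z
  rw [show law P (fun ω => (a ω, (t ω, d ω), s ω)) (x, (z, w), y) =
    law P (fun ω => ((a ω, s ω), (d ω, t ω))) ((x, y), (w, z)) from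
      congrArg P.real (by ext; simp; tauto)] at i1
  rw [show law P (fun ω => ((t ω, d ω), s ω)) ((z, w), y) =
    law P (fun ω => (s ω, d ω, t ω)) (y, w, z) from
      congrArg P.real (by ext; simp; tauto)] at i1
  rw [i1]
  linear_combination law P (fun ω => (a ω, s ω)) (x, y) * i2

omit [MeasurableSpace Ω] [Fintype 𝒴] [Fintype 𝒮] in
theorem polarU_child_child (n : ℕ) (i : Fin (2 ^ n)) (ω : Ω) :
    polarU (sh 0 X) (n + 2) (child (child i 0) 0) ω =
      polarU (sh 0 X) n i ω + polarU (sh (2 ^ n) X) n i ω +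
        (polarU (sh (2 * 2 ^ n) X) n i ω + polarU (sh (3 * 2 ^ n) X) n i ω) := by
  rw [polarU_child_zero, polarU_child_zero, polarU_child_zero, sh_sh, sh_sh, sh_sh]
  congr 4 <;> ring_nf

omit [MeasurableSpace Ω] [Fintype 𝒴] [Fintype 𝒮] in
theorem polarQ_child_child (n : ℕ) (i : Fin (2 ^ n)) (ω ω' : Ω) :
    polarQ (sh 0 X) (sh 0 Y) (n + 2) (child (child i 0) 0) ω =
        polarQ (sh 0 X) (sh 0 Y) (n + 2) (child (child i 0) 0) ω' ↔
      (polarQ (sh 0 X) (sh 0 Y) n i ω = polarQ (sh 0 X) (sh 0 Y) n i ω' ∧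
      polarQ (sh (2 ^ n) X) (sh (2 ^ n) Y) n i ω =
        polarQ (sh (2 ^ n) X) (sh (2 ^ n) Y) n i ω') ∧
      polarQ (sh (2 * 2 ^ n) X) (sh (2 * 2 ^ n) Y) n i ω =
        polarQ (sh (2 * 2 ^ n) X) (sh (2 * 2 ^ n) Y) n i ω' ∧
      polarQ (sh (3 * 2 ^ n) X) (sh (3 * 2 ^ n) Y) n i ω =
        polarQ (sh (3 * 2 ^ n) X) (sh (3 * 2 ^ n) Y) n i ω' := by
  rw [polarQ_child_zero, polarQ_child_zero, polarQ_child_zero,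
    show (2 : ℤ) ^ n + 0 = 2 ^ n by ring, show (2 : ℤ) ^ (n + 1) + 0 = 2 * 2 ^ n by ring,
    show (2 : ℤ) ^ n + 2 * 2 ^ n = 3 * 2 ^ n by ring]

/-- Lower bound for the conditional entropy of a sum of four bits by that of the sum of the outer
bits, given the boundary states of the outer blocks. -/
theorem ent_outer_le {κ σ ρ : Type*} [Fintype κ] [Fintype σ] [Fintype ρ]
    {V₁ V₂ V₃ V₄ U : Ω → ZMod 2} {q₁ q₂ q₃ q₄ : Ω → κ} {s₀ s₁ s₃ s₄ : Ω → σ} {R : Ω → ρ}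
    (dV₁ : Discr V₁) (dV₂ : Discr V₂) (dV₃ : Discr V₃) (dV₄ : Discr V₄)
    (dq₁ : Discr q₁) (dq₂ : Discr q₂) (dq₃ : Discr q₃) (dq₄ : Discr q₄)
    (ds₀ : Discr s₀) (ds₁ : Discr s₁) (ds₃ : Discr s₃) (ds₄ : Discr s₄) (dR : Discr R)
    (hU : ∀ ω, U ω = V₁ ω + V₂ ω + (V₃ ω + V₄ ω))
    (hR : ∀ ω ω', R ω = R ω' ↔
      (q₁ ω = q₁ ω' ∧ q₂ ω = q₂ ω') ∧ q₃ ω = q₃ ω' ∧ q₄ ω = q₄ ω')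
    (h1 : CondIndepGiven P (fun ω => (V₁ ω, q₁ ω, s₀ ω))
      (fun ω => ((V₂ ω, V₃ ω, q₂ ω, q₃ ω), s₃ ω, (V₄ ω, q₄ ω, s₄ ω))) s₁)
    (h2 : CondIndepGiven P (fun ω => (s₁ ω, (V₂ ω, V₃ ω, q₂ ω, q₃ ω)))
      (fun ω => (V₄ ω, q₄ ω, s₄ ω)) s₃) :
    ent P (fun ω => (V₁ ω + V₄ ω, (q₁ ω, s₁ ω, s₀ ω), (q₄ ω, s₄ ω, s₃ ω))) -
        ent P (fun ω => ((q₁ ω, s₁ ω, s₀ ω), (q₄ ω, s₄ ω, s₃ ω))) ≤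
      ent P (fun ω => (U ω, R ω)) - ent P R := by
  have dm := dV₂.prodMk (dV₃.prodMk (dq₂.prodMk dq₃))
  have da := dV₁.prodMk (dq₁.prodMk ds₀)
  have da' := dq₁.prodMk ds₀
  have dd := dV₄.prodMk (dq₄.prodMk ds₄)
  have dd' := dq₄.prodMk ds₄
  have du : Discr (fun _ : Ω => ()) := discr_of_singleton fun a => by simp
  have dW : Discr (fun ω => V₁ ω + V₄ ω) := (dV₁.prodMk dV₄).comp fun x => x.1 + x.2
  have dU : Discr U := by
    have := (dV₁.prodMk (dV₂.prodMk (dV₃.prodMk dV₄))).comp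
      fun x => x.1 + x.2.1 + (x.2.2.1 + x.2.2.2)
    rwa [show U = fun ω => V₁ ω + V₂ ω + (V₃ ω + V₄ ω) from funext hU]
  have dA := dq₁.prodMk (ds₁.prodMk ds₀)
  have dD := dq₄.prodMk (ds₄.prodMk ds₃)
  have dg := dV₂.prodMk (dV₃.prodMk (ds₁.prodMk (ds₀.prodMk (ds₄.prodMk ds₃))))
  -- Comparing `c1` with `c3` and `c2` with `c4` shows that the middle adds the same entropy with
  -- and without the outer bits. The unit variable stands for an absent middle.
  have c1 := ent_markov_chain da ds₁ dm ds₃ dd h1 h2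
  have c2 := ent_markov_chain da' ds₁ dm ds₃ dd'
    (h1.mono (fun ω ω' _ hw => by simp only [Prod.mk.injEq] at hw ⊢; tauto)
      (fun ω ω' _ hw => by simp only [Prod.mk.injEq] at hw ⊢; tauto))
    (h2.mono (fun ω ω' _ hw => hw) (fun ω ω' _ hw => by simp only [Prod.mk.injEq] at hw ⊢; tauto))
  have c3 := ent_markov_chain da ds₁ du ds₃ dd
    (h1.mono (fun ω ω' _ hw => hw) (fun ω ω' _ hw => by simp only [Prod.mk.injEq] at hw ⊢; tauto))
    (h2.mono (fun ω ω' _ hw => by simp only [Prod.mk.injEq] at hw ⊢; tauto) (fun ω ω' _ hw => hw))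
  have c4 := ent_markov_chain da' ds₁ du ds₃ dd'
    (h1.mono (fun ω ω' _ hw => by simp only [Prod.mk.injEq] at hw ⊢; tauto)
      (fun ω ω' _ hw => by simp only [Prod.mk.injEq] at hw ⊢; tauto))
    (h2.mono (fun ω ω' _ hw => by simp only [Prod.mk.injEq] at hw ⊢; tauto)
      (fun ω ω' _ hw => by simp only [Prod.mk.injEq] at hw ⊢; tauto))
  -- Revealing `V₂`, `V₃` and the boundary states lowers the entropy and reduces `U` to `V₁ + V₄`.
  have i1 := ent_sub_le_of_cond (P := P) dU dg dR
  -- Given only the sum `V₁ + V₄`, the middle is at least as uncertain as given both outer bits. By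
  -- `c1`–`c4` this suffices to discard the middle.
  have i2 := ent_submodular (P := P) (dV₁.prodMk dV₄) dm (dW.prodMk (dA.prodMk dD))
  have e1 : ent P (fun ω => (U ω, (V₂ ω, V₃ ω, s₁ ω, s₀ ω, s₄ ω, s₃ ω), R ω)) =
      ent P (fun ω => ((V₂ ω, V₃ ω, q₂ ω, q₃ ω), V₁ ω + V₄ ω, (q₁ ω, s₁ ω, s₀ ω),
        (q₄ ω, s₄ ω, s₃ ω))) :=
    ent_congr (dU.prodMk (dg.prodMk dR)) fun ω ω' => by
      have hcancel : V₂ ω = V₂ ω' → V₃ ω = V₃ ω' →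
          (V₁ ω + V₂ ω + (V₃ ω + V₄ ω) = V₁ ω' + V₂ ω' + (V₃ ω' + V₄ ω') ↔
            V₁ ω + V₄ ω = V₁ ω' + V₄ ω') := by
        intro a b
        rw [a, b]
        constructor <;> intro hh <;> linear_combination hh
      simp only [Prod.mk.injEq, hR, hU]
      tauto
  have e2 : ent P (fun ω => ((V₂ ω, V₃ ω, s₁ ω, s₀ ω, s₄ ω, s₃ ω), R ω)) =
      ent P (fun ω => ((q₁ ω, s₀ ω), s₁ ω, (V₂ ω, V₃ ω, q₂ ω, q₃ ω), s₃ ω, (q₄ ω, s₄ ω))) :=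
    ent_congr (dg.prodMk dR) fun ω ω' => by
      simp only [Prod.mk.injEq, hR]
      tauto
  have hadd : ∀ ω ω', V₁ ω = V₁ ω' → V₄ ω = V₄ ω' → V₁ ω + V₄ ω = V₁ ω' + V₄ ω' :=
    fun ω ω' a b => by rw [a, b]
  have e3 : ent P (fun ω => ((V₁ ω, V₄ ω), (V₂ ω, V₃ ω, q₂ ω, q₃ ω), V₁ ω + V₄ ω,
      (q₁ ω, s₁ ω, s₀ ω), (q₄ ω, s₄ ω, s₃ ω))) = ent P (fun ω => ((V₁ ω, q₁ ω, s₀ ω), s₁ ω,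
        (V₂ ω, V₃ ω, q₂ ω, q₃ ω), s₃ ω, (V₄ ω, q₄ ω, s₄ ω))) :=
    ent_congr ((dV₁.prodMk dV₄).prodMk (dm.prodMk (dW.prodMk (dA.prodMk dD)))) fun ω ω' => by
      have := hadd ω ω'
      simp only [Prod.mk.injEq]
      tauto
  have e4 : ent P (fun ω => ((V₁ ω, V₄ ω), V₁ ω + V₄ ω, (q₁ ω, s₁ ω, s₀ ω),
      (q₄ ω, s₄ ω, s₃ ω))) = ent P (fun ω => ((V₁ ω, q₁ ω, s₀ ω), s₁ ω, (), s₃ ω,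
        (V₄ ω, q₄ ω, s₄ ω))) :=
    ent_congr ((dV₁.prodMk dV₄).prodMk (dW.prodMk (dA.prodMk dD))) fun ω ω' => by
      have := hadd ω ω'
      simp only [Prod.mk.injEq]
      tauto
  have e5 : ent P (fun ω => ((q₁ ω, s₁ ω, s₀ ω), (q₄ ω, s₄ ω, s₃ ω))) =
      ent P (fun ω => ((q₁ ω, s₀ ω), s₁ ω, (), s₃ ω, (q₄ ω, s₄ ω))) :=
    ent_congr (dA.prodMk dD) fun ω ω' => by
      simp only [Prod.mk.injEq]
      tauto
  linarith

omit [MeasurableSpace Ω] [Fintype 𝒴] [Fintype 𝒮] in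
theorem polar_congr {n : ℕ} (i : Fin (2 ^ n)) {t : ℤ} {ω ω' : Ω}
    (hl : ∀ l, t < l → l ≤ t + 2 ^ n → X l ω = X l ω' ∧ Y l ω = Y l ω') :
    polarU (sh t X) n i ω = polarU (sh t X) n i ω' ∧
      polarQ (sh t X) (sh t Y) n i ω = polarQ (sh t X) (sh t Y) n i ω' := by
  have hX : block (sh t X) (2 ^ n) ω = block (sh t X) (2 ^ n) ω' :=
    block_eq_iff.2 fun l h1 h2 => (hl l h1 (by push_cast at h2; exact h2)).1
  have hY : block (sh t Y) (2 ^ n) ω = block (sh t Y) (2 ^ n) ω' :=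
    block_eq_iff.2 fun l h1 h2 => (hl l h1 (by push_cast at h2; exact h2)).2
  exact ⟨polarU_congr i hX, polarQ_congr i hX hY⟩

/-- Two consecutive minus steps increase the entropy by a definite amount. -/
theorem IsFAIM.exists_gain (h : IsFAIM P X Y S) :
    ∃ c : ℝ, 0 < c ∧ ∃ n₀ : ℕ, ∀ n ≥ n₀, ∀ i : Fin (2 ^ n),
      bsiIndexEntropy P X Y S n i +
        c * ((1 - bsiIndexEntropy P X Y S n i) * bsiIndexEntropy P X Y S n i ^ 2) ≤
      indexEntropy P X Y (n + 2) (child (child i 0) 0) := by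
  obtain ⟨c, hc, n₀, hn₀⟩ := h.exists_mixing
  refine ⟨c / 20, by positivity, n₀, fun n hn i => ?_⟩
  have hlog := Real.log_pos one_lt_two
  have b0 := h.condEntropy_sh 0 n i
  have b3 := h.condEntropy_sh (3 * 2 ^ n) n i
  rw [zero_add] at b0
  rw [show (3 : ℤ) * 2 ^ n + 2 ^ n = 4 * 2 ^ n by ring] at b3
  have hU := polarU_child_child (X := X) n i
  have hR := polarQ_child_child (X := X) (Y := Y) n i
  -- The inner states of the outer blocks are `2 * 2 ^ n` apart, which is beyond the mixing
  -- threshold because `2 ^ n > n ≥ n₀`.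
  have hmix : ∀ a b, c * (law P (S 0) a * law P (S 0) b) ≤
      law P (fun ω => (S (2 ^ n) ω, S (3 * 2 ^ n) ω)) (a, b) := by
    intro a b
    have := hn₀ (2 * 2 ^ n) (by have := (Nat.lt_two_pow_self (n := n)); omega) (2 ^ n) a b
    rwa [show (2 : ℤ) ^ n + (2 * 2 ^ n : ℕ) = 3 * 2 ^ n by push_cast; ring] at this
  rw [← mul_le_mul_iff_left₀ hlog, h.indexEntropy_mul]
  have dV := fun t => h.discr_polarU t n i
  have dq := fun t => h.discr_polarQ t n i
  have ds := h.discr_S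
  have hp : (0 : ℤ) < 2 ^ n := by positivity
  have hcast : ((3 * 2 ^ n : ℕ) : ℤ) = 3 * 2 ^ n := by push_cast; ring
  have h1 : CondIndepGiven P (fun ω => (polarU (sh 0 X) n i ω, polarQ (sh 0 X) (sh 0 Y) n i ω,
      S 0 ω)) (fun ω => ((polarU (sh (2 ^ n) X) n i ω, polarU (sh (2 * 2 ^ n) X) n i ω,
        polarQ (sh (2 ^ n) X) (sh (2 ^ n) Y) n i ω,
        polarQ (sh (2 * 2 ^ n) X) (sh (2 * 2 ^ n) Y) n i ω), S (3 * 2 ^ n) ω,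
        (polarU (sh (3 * 2 ^ n) X) n i ω, polarQ (sh (3 * 2 ^ n) X) (sh (3 * 2 ^ n) Y) n i ω,
          S (4 * 2 ^ n) ω))) (S (2 ^ n)) := by
    refine h.condIndep (2 ^ n) (3 * 2 ^ n) (fun ω ω' _ hl => ?_) (fun ω ω' _ hl => ?_)
    · rw [hcast] at hl
      obtain ⟨a1, a2⟩ := polar_congr (X := X) (Y := Y) i (t := 0) (ω := ω) (ω' := ω')
        fun l l1 l2 => ⟨(hl l (by omega) (by omega)).1, (hl l (by omega) (by omega)).2.1⟩
      have a3 : S 0 ω = S 0 ω' := by simpa using (hl 1 (by omega) (by omega)).2.2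
      rw [a1, a2, a3]
    · rw [hcast] at hl
      obtain ⟨a1, a2⟩ := polar_congr (X := X) (Y := Y) i (t := 2 ^ n) (ω := ω) (ω' := ω')
        fun l l1 l2 => ⟨(hl l (by omega) (by omega)).1, (hl l (by omega) (by omega)).2.1⟩
      obtain ⟨a3, a4⟩ := polar_congr (X := X) (Y := Y) i (t := 2 * 2 ^ n) (ω := ω) (ω' := ω')
        fun l l1 l2 => ⟨(hl l (by omega) (by omega)).1, (hl l (by omega) (by omega)).2.1⟩
      obtain ⟨a5, a6⟩ := polar_congr (X := X) (Y := Y) i (t := 3 * 2 ^ n) (ω := ω) (ω' := ω')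
        fun l l1 l2 => ⟨(hl l (by omega) (by omega)).1, (hl l (by omega) (by omega)).2.1⟩
      have a7 := (hl (3 * 2 ^ n) (by omega) (by omega)).2.2
      have a8 := (hl (4 * 2 ^ n) (by omega) (by omega)).2.2
      rw [a1, a2, a3, a4, a5, a6, a7, a8]
  have h2 : CondIndepGiven P (fun ω => (S (2 ^ n) ω, (polarU (sh (2 ^ n) X) n i ω,
        polarU (sh (2 * 2 ^ n) X) n i ω, polarQ (sh (2 ^ n) X) (sh (2 ^ n) Y) n i ω,
        polarQ (sh (2 * 2 ^ n) X) (sh (2 * 2 ^ n) Y) n i ω)))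
      (fun ω => (polarU (sh (3 * 2 ^ n) X) n i ω,
        polarQ (sh (3 * 2 ^ n) X) (sh (3 * 2 ^ n) Y) n i ω, S (4 * 2 ^ n) ω))
      (S (3 * 2 ^ n)) := by
    refine h.condIndep (3 * 2 ^ n) (3 * 2 ^ n) (fun ω ω' _ hl => ?_) (fun ω ω' _ hl => ?_)
    · rw [hcast] at hl
      obtain ⟨a1, a2⟩ := polar_congr (X := X) (Y := Y) i (t := 2 ^ n) (ω := ω) (ω' := ω')
        fun l l1 l2 => ⟨(hl l (by omega) (by omega)).1, (hl l (by omega) (by omega)).2.1⟩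
      obtain ⟨a3, a4⟩ := polar_congr (X := X) (Y := Y) i (t := 2 * 2 ^ n) (ω := ω) (ω' := ω')
        fun l l1 l2 => ⟨(hl l (by omega) (by omega)).1, (hl l (by omega) (by omega)).2.1⟩
      have a5 := (hl (2 ^ n + 1) (by omega) (by omega)).2.2
      rw [add_sub_cancel_right] at a5
      rw [a1, a2, a3, a4, a5]
    · rw [hcast] at hl
      obtain ⟨a1, a2⟩ := polar_congr (X := X) (Y := Y) i (t := 3 * 2 ^ n) (ω := ω) (ω' := ω')
        fun l l1 l2 => ⟨(hl l (by omega) (by omega)).1, (hl l (by omega) (by omega)).2.1⟩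
      have a3 := (hl (4 * 2 ^ n) (by omega) (by omega)).2.2
      rw [a1, a2, a3]
  have outer := ent_outer_le (dV 0) (dV (2 ^ n)) (dV (2 * 2 ^ n)) (dV (3 * 2 ^ n)) (dq 0)
    (dq (2 ^ n)) (dq (2 * 2 ^ n)) (dq (3 * 2 ^ n)) (ds 0) (ds (2 ^ n)) (ds (3 * 2 ^ n))
    (ds (4 * 2 ^ n)) (h.discr_polarQ 0 (n + 2) (child (child i 0) 0)) hU hR h1 h2
  refine le_trans ?_ outer
  have dA := (dq 0).prodMk ((ds (2 ^ n)).prodMk (ds 0))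
  have dD := (dq (3 * 2 ^ n)).prodMk ((ds (4 * 2 ^ n)).prodMk (ds (3 * 2 ^ n)))
  have dW : Discr (fun ω => polarU (sh 0 X) n i ω + polarU (sh (3 * 2 ^ n) X) n i ω) :=
    ((dV 0).prodMk (dV (3 * 2 ^ n))).comp fun x => x.1 + x.2
  rw [← condEntropy_mul_log_two dW (dA.prodMk dD), mul_le_mul_iff_left₀ hlog]
  -- The outer data have the product of their marginals as joint law, up to the density of the two
  -- inner states. Both hypotheses of `condEntropy_add_ge` follow by cancelling the positive state
  -- masses.
  have hAD : ∀ q s s' q' t' t, law P (fun ω => ((polarQ (sh 0 X) (sh 0 Y) n i ω, S (2 ^ n) ω,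
      S 0 ω), (polarQ (sh (3 * 2 ^ n) X) (sh (3 * 2 ^ n) Y) n i ω, S (4 * 2 ^ n) ω,
        S (3 * 2 ^ n) ω))) ((q, s, s'), (q', t', t)) * law P (S (2 ^ n)) s *
        law P (S (3 * 2 ^ n)) t =
      law P (fun ω => (polarQ (sh 0 X) (sh 0 Y) n i ω, S (2 ^ n) ω, S 0 ω)) (q, s, s') *
        law P (fun ω => (S (2 ^ n) ω, S (3 * 2 ^ n) ω)) (s, t) *
      law P (fun ω => (polarQ (sh (3 * 2 ^ n) X) (sh (3 * 2 ^ n) Y) n i ω, S (4 * 2 ^ n) ω,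
        S (3 * 2 ^ n) ω)) (q', t', t) := by
    intro q s s' q' t' t
    have k := law_markov_chain (d := fun ω =>
        (polarQ (sh (3 * 2 ^ n) X) (sh (3 * 2 ^ n) Y) n i ω, S (4 * 2 ^ n) ω))
      (h1.mono (fun ω ω' _ hw => (Prod.ext_iff.1 hw).2)
        fun ω ω' _ hw => by simp only [Prod.mk.injEq] at hw ⊢; tauto)
      (h2.mono (fun ω ω' _ hw => (Prod.ext_iff.1 hw).1)
        fun ω ω' _ hw => (Prod.ext_iff.1 hw).2) (q, s') s t (q', t')
    dsimp only at k
    convert k using 3 <;> exact congrArg P.real (by ext; simp; tauto)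
  have key := condEntropy_add_ge (P := P) (dV 0) (dV (3 * 2 ^ n)) dA dD hc.le ?_ ?_
  · rwa [b0, b3] at key
  · rintro v ⟨q, s, s'⟩ w ⟨q', t', t⟩
    have hs := h.law_S_pos s
    have ht := h.law_S_pos t
    rw [← h.law_S (2 ^ n)] at hs
    rw [← h.law_S (3 * 2 ^ n)] at ht
    have k1 := law_markov_chain (h1.mono (fun ω ω' _ hw => hw) fun ω ω' _ hw =>
      (Prod.ext_iff.1 hw).2) (h2.mono (fun ω ω' _ hw => (Prod.ext_iff.1 hw).1)
        fun ω ω' _ hw => hw) (v, q, s') s t (w, q', t')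
    have k2 := hAD q s s' q' t' t
    have k1' : law P (fun ω => ((polarU (sh 0 X) n i ω, polarQ (sh 0 X) (sh 0 Y) n i ω, S (2 ^ n) ω,
        S 0 ω), (polarU (sh (3 * 2 ^ n) X) n i ω,
          polarQ (sh (3 * 2 ^ n) X) (sh (3 * 2 ^ n) Y) n i ω, S (4 * 2 ^ n) ω,
          S (3 * 2 ^ n) ω))) ((v, q, s, s'), (w, q', t', t)) * law P (S (2 ^ n)) s *
          law P (S (3 * 2 ^ n)) t =
        law P (fun ω => (polarU (sh 0 X) n i ω, polarQ (sh 0 X) (sh 0 Y) n i ω, S (2 ^ n) ω,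
          S 0 ω)) (v, q, s, s') * law P (fun ω => (S (2 ^ n) ω, S (3 * 2 ^ n) ω)) (s, t) *
        law P (fun ω => (polarU (sh (3 * 2 ^ n) X) n i ω,
          polarQ (sh (3 * 2 ^ n) X) (sh (3 * 2 ^ n) Y) n i ω, S (4 * 2 ^ n) ω,
          S (3 * 2 ^ n) ω)) (w, q', t', t) := by
      convert k1 using 3 <;> exact congrArg P.real (by ext; simp; tauto)
    refine mul_right_cancel₀ (mul_pos hs ht).ne' ?_
    linear_combination law P (fun ω => (polarQ (sh 0 X) (sh 0 Y) n i ω, S (2 ^ n) ω, S 0 ω))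
      (q, s, s') * law P (fun ω => (polarQ (sh (3 * 2 ^ n) X) (sh (3 * 2 ^ n) Y) n i ω,
        S (4 * 2 ^ n) ω, S (3 * 2 ^ n) ω)) (q', t', t) * k1' -
      law P (fun ω => (polarU (sh 0 X) n i ω, polarQ (sh 0 X) (sh 0 Y) n i ω, S (2 ^ n) ω,
        S 0 ω)) (v, q, s, s') * law P (fun ω => (polarU (sh (3 * 2 ^ n) X) n i ω,
          polarQ (sh (3 * 2 ^ n) X) (sh (3 * 2 ^ n) Y) n i ω, S (4 * 2 ^ n) ω,
          S (3 * 2 ^ n) ω)) (w, q', t', t) * k2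
  · rintro ⟨q, s, s'⟩ ⟨q', t', t⟩
    have hs := h.law_S_pos s
    have ht := h.law_S_pos t
    have hm := hmix s t
    rw [← h.law_S (2 ^ n)] at hs
    rw [← h.law_S (3 * 2 ^ n)] at ht
    rw [← h.law_S (2 ^ n) s, ← h.law_S (3 * 2 ^ n) t] at hm
    have k2 := hAD q s s' q' t' t
    refine le_of_mul_le_mul_right ?_ (mul_pos hs ht)
    rw [mul_assoc] at k2
    rw [k2]
    have := mul_le_mul_of_nonneg_left hm (mul_nonneg
      (law_nonneg P (fun ω => (polarQ (sh 0 X) (sh 0 Y) n i ω, S (2 ^ n) ω, S 0 ω)) (q, s, s'))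
      (law_nonneg P (fun ω => (polarQ (sh (3 * 2 ^ n) X) (sh (3 * 2 ^ n) Y) n i ω,
        S (4 * 2 ^ n) ω, S (3 * 2 ^ n) ω)) (q', t', t)))
    linarith

end MinusMinus

/-! ## The random index -/

section Index

variable {Ω' : Type*} [mΩ : MeasurableSpace Ω'] {μ : Measure Ω'} {B : ℕ → Ω' → Fin 2}

omit mΩ in
theorem bitIndex_succ (n : ℕ) (ω : Ω') :
    bitIndex B (n + 1) ω = child (bitIndex B n ω) (B n ω) := by
  apply Fin.ext
  rw [child_val, bitIndex, bitIndex, finFunctionFinEquiv_apply, finFunctionFinEquiv_apply,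
    Fin.sum_univ_succ, Finset.mul_sum]
  simp only [Fin.rev_zero, Fin.val_last, Fin.val_zero, pow_zero, mul_one, Fin.rev_succ,
    Fin.val_castSucc, Fin.val_succ, pow_succ]
  congr 1
  exact Finset.sum_congr rfl fun i _ => by ring

/-- The index of the parent. -/
def parent {n : ℕ} (k : Fin (2 ^ (n + 1))) : Fin (2 ^ n) :=
  ((finProdFinEquiv (m := 2 ^ n) (n := 2)).symm k).1

theorem parent_child {n : ℕ} (i : Fin (2 ^ n)) (b : Fin 2) : parent (child i b) = i :=
  congrArg Prod.fst ((finProdFinEquiv (m := 2 ^ n) (n := 2)).symm_apply_apply (i, b))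

omit mΩ in
theorem parent_bitIndex (n : ℕ) (ω : Ω') : parent (bitIndex B (n + 1) ω) = bitIndex B n ω := by
  rw [bitIndex_succ, parent_child]

omit mΩ in
-- Level sets of the index are cylinder events in the bits. Placing `k < n` inside the set lets the
-- intersection run over a `Finset` of naturals, as independence of `B` requires.
theorem bitIndex_preimage (n : ℕ) (f : Fin n → Fin 2) :
    bitIndex B n ⁻¹' {finFunctionFinEquiv f} =
      ⋂ k ∈ Finset.range n, B k ⁻¹' {b | ∀ hk : k < n, b = f (Fin.rev ⟨k, hk⟩)} := by
  ext ω
  simp only [Set.mem_preimage, Set.mem_singleton_iff, bitIndex, EmbeddingLike.apply_eq_iff_eq,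
    funext_iff, Set.mem_iInter, Finset.mem_range, Set.mem_ofPred_eq]
  refine ⟨fun h k _ hk => ?_, fun h j => ?_⟩
  · simpa using h (Fin.rev ⟨k, hk⟩)
  · have := h (j.rev : ℕ) j.rev.2 j.rev.2
    rwa [Fin.eta, Fin.rev_rev] at this

theorem IsFairBits.measurable_bitIndex_filtration (hB : IsFairBits μ B) (n : ℕ) :
    Measurable[bitFiltration B hB.measurable n] (bitIndex B n) := by
  have hBk : ∀ k < n, Measurable[bitFiltration B hB.measurable n] (B k) := fun k hk =>
    (comap_measurable (B k)).mono (le_biSup (fun j => MeasurableSpace.comap (B j) inferInstance) hk)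
      le_rfl
  refine @measurable_to_countable' _ _ _ _ (_) _ fun i => ?_
  obtain ⟨f, rfl⟩ := finFunctionFinEquiv.surjective i
  rw [bitIndex_preimage]
  exact Finset.measurableSet_biInter _ fun k hk =>
    hBk k (Finset.mem_range.1 hk) (MeasurableSet.of_discrete)

theorem IsFairBits.measurable_bitIndex (hB : IsFairBits μ B) (n : ℕ) :
    Measurable (bitIndex B n) :=
  (hB.measurable_bitIndex_filtration n).mono ((bitFiltration B hB.measurable).le n) le_rfl

/-- The first `n` bits are functions of the index, so integrals over events of the filtration become
finite sums over indices. -/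
theorem IsFairBits.exists_eq_preimage (hB : IsFairBits μ B) {n : ℕ} {s : Set Ω'}
    (hs : MeasurableSet[bitFiltration B hB.measurable n] s) :
    ∃ T : Set (Fin (2 ^ n)), s = bitIndex B n ⁻¹' T := by
  have hle : (bitFiltration B hB.measurable n : MeasurableSpace Ω') ≤
      MeasurableSpace.comap (bitIndex B n) ⊤ := by
    refine iSup₂_le fun k hk => ?_
    have : B k = (fun i : Fin (2 ^ n) => finFunctionFinEquiv.symm i (Fin.rev ⟨k, hk⟩)) ∘
        bitIndex B n := by
      funext ω
      simp only [bitIndex, Function.comp_apply, Equiv.symm_apply_apply, Fin.rev_rev]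
    rw [this, ← MeasurableSpace.comap_comp]
    exact MeasurableSpace.comap_mono le_top
  obtain ⟨T, -, rfl⟩ := hle _ hs
  exact ⟨T, rfl⟩

theorem IsFairBits.measure_bitIndex (hB : IsFairBits μ B) (n : ℕ) (i : Fin (2 ^ n)) :
    μ (bitIndex B n ⁻¹' {i}) = (1 / 2) ^ n := by
  obtain ⟨f, rfl⟩ := finFunctionFinEquiv.surjective i
  rw [bitIndex_preimage, hB.indep.measure_inter_preimage_eq_mul _ fun _ _ => .of_discrete]
  rw [Finset.prod_congr rfl (g := fun _ => 1 / 2)]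
  · simp
  · intro k hk
    rw [← hB.uniform k (f (Fin.rev ⟨k, Finset.mem_range.1 hk⟩))]
    congr 1
    ext ω
    simp [Finset.mem_range.1 hk]

variable [IsProbabilityMeasure μ]

theorem IsFairBits.integrable_comp (hB : IsFairBits μ B) (n : ℕ) (F : Fin (2 ^ n) → ℝ) :
    Integrable (fun ω => F (bitIndex B n ω)) μ := by
  have hm : Measurable fun ω => F (bitIndex B n ω) :=
    (measurable_of_countable F).comp (hB.measurable_bitIndex n)
  obtain ⟨C, hC⟩ := (Set.finite_range fun i => ‖F i‖).bddAbove
  exact Integrable.of_bound hm.aestronglyMeasurable C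
    (Eventually.of_forall fun ω => hC ⟨_, rfl⟩)

theorem IsFairBits.integral_comp (hB : IsFairBits μ B) (n : ℕ) (F : Fin (2 ^ n) → ℝ) :
    ∫ ω, F (bitIndex B n ω) ∂μ = (∑ i, F i) / 2 ^ n := by
  have hm := hB.measurable_bitIndex n
  have h1 : ∫ ω, F (bitIndex B n ω) ∂μ = ∫ i, F i ∂(μ.map (bitIndex B n)) :=
    (integral_map hm.aemeasurable (measurable_of_countable F).aestronglyMeasurable).symm
  have : IsProbabilityMeasure (μ.map (bitIndex B n)) :=
    Measure.isProbabilityMeasure_map hm.aemeasurable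
  rw [h1, integral_fintype (Integrable.of_finite), Finset.sum_div]
  refine Finset.sum_congr rfl fun i _ => ?_
  rw [measureReal_def, Measure.map_apply hm (.of_discrete), hB.measure_bitIndex]
  simp [div_eq_inv_mul]

/-- An event of level `n` selects a set of parents, so the integral at level `n + 1` runs over
complete pairs of siblings, and `hF` applies to each pair. -/
theorem IsFairBits.submartingale (hB : IsFairBits μ B) (F : ∀ n, Fin (2 ^ n) → ℝ)
    (hF : ∀ n i, 2 * F n i ≤ F (n + 1) (child i 0) + F (n + 1) (child i 1)) :
    Submartingale (fun n ω => F n (bitIndex B n ω)) (bitFiltration B hB.measurable) μ := by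
  classical
  refine submartingale_of_setIntegral_le_succ (fun n => ?_) (fun n => hB.integrable_comp n (F n))
    fun n s hs => ?_
  · exact ((measurable_of_countable (F n)).comp
      (hB.measurable_bitIndex_filtration n)).stronglyMeasurable
  · obtain ⟨T, rfl⟩ := hB.exists_eq_preimage hs
    have hT : MeasurableSet (bitIndex B n ⁻¹' T) := hB.measurable_bitIndex n .of_discrete
    rw [← integral_indicator hT, ← integral_indicator hT]
    have e1 : (bitIndex B n ⁻¹' T).indicator (fun ω => F n (bitIndex B n ω)) =
        fun ω => (fun i => if i ∈ T then F n i else 0) (bitIndex B n ω) := by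
      funext ω; simp [Set.indicator_apply]
    have e2 : (bitIndex B n ⁻¹' T).indicator (fun ω => F (n + 1) (bitIndex B (n + 1) ω)) =
        fun ω => (fun k => if parent k ∈ T then F (n + 1) k else 0) (bitIndex B (n + 1) ω) := by
      funext ω; simp [Set.indicator_apply, parent_bitIndex]
    rw [e1, e2, hB.integral_comp, hB.integral_comp, sum_child, pow_succ,
      div_le_div_iff₀ (by positivity) (by positivity)]
    have hsum : 2 * ∑ i, (if i ∈ T then F n i else 0) ≤
        ∑ i : Fin (2 ^ n), ((if parent (child i 0) ∈ T then F (n + 1) (child i 0) else 0) +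
          (if parent (child i 1) ∈ T then F (n + 1) (child i 1) else 0)) := by
      rw [Finset.mul_sum]
      refine Finset.sum_le_sum fun i _ => ?_
      rw [parent_child, parent_child]
      split_ifs
      · exact hF n i
      · simp
    have := mul_le_mul_of_nonneg_right hsum (by positivity : (0 : ℝ) ≤ 2 ^ n)
    linarith

/-- The natural filtration is coarser, so the inequality is required on fewer events. -/
theorem submartingale_natural {f : ℕ → Ω' → ℝ} {ℱ : Filtration ℕ mΩ} (hf : Submartingale f ℱ μ)
    (hm : ∀ n, StronglyMeasurable (f n)) : Submartingale f (Filtration.natural f hm) μ := by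
  refine submartingale_of_setIntegral_le_succ (Filtration.stronglyAdapted_natural hm) hf.2.2
    fun n s hs => hf.setIntegral_le n.le_succ ?_
  have hle : (Filtration.natural f hm n : MeasurableSpace Ω') ≤ ℱ n :=
    iSup₂_le fun k hk => ((hf.1 k).mono (ℱ.mono hk)).measurable.comap_le
  exact hle s hs

/-- Almost sure convergence of functions of the random index gives convergence of averages. -/
theorem IsFairBits.tendsto_average (hB : IsFairBits μ B) {F : ∀ n, Fin (2 ^ n) → ℝ}
    (hF : ∀ n i, |F n i| ≤ 1) {L : Ω' → ℝ}
    (hL : ∀ᵐ ω ∂μ, Tendsto (fun n => F n (bitIndex B n ω)) atTop (𝓝 (L ω))) :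
    Tendsto (fun n => (∑ i, F n i) / 2 ^ n) atTop (𝓝 (∫ ω, L ω ∂μ)) := by
  simp_rw [← hB.integral_comp]
  exact tendsto_integral_of_dominated_convergence (fun _ => 1)
    (fun n => (hB.integrable_comp n (F n)).aestronglyMeasurable) (integrable_const 1)
    (fun n => Eventually.of_forall fun ω => hF n _) hL

omit [IsProbabilityMeasure μ] in
-- The sum of the functions has finite integral, so it is finite almost everywhere and its terms
-- tend to zero there.
theorem ae_tendsto_zero_of_summable_integral {f : ℕ → Ω' → ℝ} (h0 : ∀ n ω, 0 ≤ f n ω)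
    (hint : ∀ n, Integrable (f n) μ) (hs : Summable fun n => ∫ ω, f n ω ∂μ) :
    ∀ᵐ ω ∂μ, Tendsto (fun n => f n ω) atTop (𝓝 0) := by
  have h1 : ∫⁻ ω, ∑' n, ENNReal.ofReal (f n ω) ∂μ ≠ ∞ := by
    rw [lintegral_tsum fun n => (hint n).aestronglyMeasurable.aemeasurable.ennreal_ofReal]
    have : ∀ n, ∫⁻ ω, ENNReal.ofReal (f n ω) ∂μ = ENNReal.ofReal (∫ ω, f n ω ∂μ) := fun n =>
      (ofReal_integral_eq_lintegral_ofReal (hint n) (Eventually.of_forall (h0 n))).symm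
    simp_rw [this]
    exact hs.tsum_ofReal_ne_top
  have h2 := ae_lt_top' (AEMeasurable.tsum fun n =>
    (hint n).aestronglyMeasurable.aemeasurable.ennreal_ofReal) h1
  filter_upwards [h2] with ω hω
  have h3 := ENNReal.tendsto_atTop_zero_of_tsum_ne_top hω.ne
  have h4 := (ENNReal.tendsto_toReal ENNReal.zero_ne_top).comp h3
  simpa [Function.comp_def, ENNReal.toReal_ofReal (h0 _ ω)] using h4

end Index

/-! ## Polarization -/

section Polarization

variable {Ω Ω' 𝒴 𝒮 : Type*} [MeasurableSpace Ω] [MeasurableSpace Ω'] [Fintype 𝒴] [Fintype 𝒮]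
  {P : Measure Ω} [IsProbabilityMeasure P]
  {X : ℤ → Ω → ZMod 2} {Y : ℤ → Ω → 𝒴} {S : ℤ → Ω → 𝒮}
  {μ : Measure Ω'} [IsProbabilityMeasure μ] {B : ℕ → Ω' → Fin 2}

theorem IsFAIM.submartingale_bsi (h : IsFAIM P X Y S) (hB : IsFairBits μ B) :
    Submartingale (bsiEntropyProc P X Y S B) (bitFiltration B hB.measurable) μ :=
  hB.submartingale (fun n i => bsiIndexEntropy P X Y S n i) h.two_mul_bsiIndexEntropy_le

omit [IsProbabilityMeasure P] [IsProbabilityMeasure μ] in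
theorem IsFairBits.stronglyMeasurable_bsi (hB : IsFairBits μ B) (n : ℕ) :
    StronglyMeasurable (bsiEntropyProc P X Y S B n) :=
  ((measurable_of_countable _).comp (hB.measurable_bitIndex n)).stronglyMeasurable

/-- The two entropy processes have the same limit. -/
theorem IsFAIM.ae_tendsto_sub (h : IsFAIM P X Y S) (hB : IsFairBits μ B) :
    ∀ᵐ ω ∂μ, Tendsto (fun n => entropyProc P X Y B n ω - bsiEntropyProc P X Y S B n ω) atTop
      (𝓝 0) := by
  have hint := fun n => hB.integrable_comp n fun i =>
    indexEntropy P X Y n i - bsiIndexEntropy P X Y S n i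
  have h0 : ∀ n i, 0 ≤ indexEntropy P X Y n i - bsiIndexEntropy P X Y S n i :=
    fun n i => sub_nonneg.2 (h.bsiIndexEntropy_le n i)
  refine ae_tendsto_zero_of_summable_integral (fun n ω => h0 n _) hint ?_
  -- The mean gap is the uniformly bounded total gap divided by `2 ^ n`, hence geometric.
  refine Summable.of_nonneg_of_le (fun n => integral_nonneg fun ω => h0 n _) (fun n => ?_)
    ((summable_geometric_two).mul_left (Real.log (Fintype.card (𝒮 × 𝒮)) / Real.log 2))
  refine (hB.integral_comp n fun i =>
    indexEntropy P X Y n i - bsiIndexEntropy P X Y S n i).trans_le ?_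
  rw [div_pow, one_pow, mul_one_div]
  exact div_le_div_of_nonneg_right (h.sum_sub_le n) (by positivity)

/-- The almost sure limit of the entropy process is `{0, 1}`-valued. -/
theorem IsFAIM.ae_zero_or_one (h : IsFAIM P X Y S) (hB : IsFairBits μ B) {g : Ω' → ℝ}
    (hH : ∀ᵐ ω ∂μ, Tendsto (fun n => entropyProc P X Y B n ω) atTop (𝓝 (g ω)))
    (hHh : ∀ᵐ ω ∂μ, Tendsto (fun n => bsiEntropyProc P X Y S B n ω) atTop (𝓝 (g ω))) :
    ∀ᵐ ω ∂μ, g ω = 0 ∨ g ω = 1 := by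
  obtain ⟨c, hc, n₀, hgain⟩ := h.exists_gain
  have b1 := fun n i => h.indexEntropy_mem_Icc n i
  have b2 := fun n i => h.bsiIndexEntropy_mem_Icc n i
  -- The gain function vanishes on `[0,1]` only at the endpoints, so it suffices that `φ ∘ g` has
  -- mean zero.
  let φ : ℝ → ℝ := fun x => (1 - x) * x ^ 2
  have hφc : Continuous φ := by fun_prop
  have hφ0 : ∀ x ∈ Set.Icc (0 : ℝ) 1, 0 ≤ φ x := fun x hx =>
    mul_nonneg (by linarith [hx.2]) (sq_nonneg x)
  have hφ1 : ∀ x ∈ Set.Icc (0 : ℝ) 1, φ x ≤ 1 := fun x hx =>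
    mul_le_one₀ (by linarith [hx.1]) (sq_nonneg x) (pow_le_one₀ hx.1 hx.2)
  have t1 := hB.tendsto_average (F := fun n i => φ (bsiIndexEntropy P X Y S n i))
    (fun n i => abs_le.2 ⟨by linarith [hφ0 _ (b2 n i)], hφ1 _ (b2 n i)⟩)
    (L := fun ω => φ (g ω)) (by
      filter_upwards [hHh] with ω hω
      exact (hφc.tendsto _).comp hω)
  let D : ∀ n, Fin (2 ^ (n + 2)) → ℝ := fun n k =>
    |indexEntropy P X Y (n + 2) k - bsiIndexEntropy P X Y S n (parent (parent k))|
  have t2 : Tendsto (fun n => (∑ k, D n k) / 2 ^ (n + 2)) atTop (𝓝 0) := by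
    have e : ∀ n, (∑ k, D n k) / 2 ^ (n + 2) =
        ∫ ω, |entropyProc P X Y B (n + 2) ω - bsiEntropyProc P X Y S B n ω| ∂μ := by
      intro n
      rw [← hB.integral_comp]
      simp only [D, parent_bitIndex]
      rfl
    simp_rw [e]
    have := tendsto_integral_of_dominated_convergence (μ := μ)
      (F := fun n ω => |entropyProc P X Y B (n + 2) ω - bsiEntropyProc P X Y S B n ω|)
      (f := fun _ => 0) (fun _ => 1) (fun n => ?_) (integrable_const 1)
      (fun n => Eventually.of_forall fun ω => ?_) ?_
    · simpa using this
    · exact ((hB.integrable_comp (n + 2) (indexEntropy P X Y (n + 2))).sub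
        (hB.integrable_comp n (bsiIndexEntropy P X Y S n))).abs.aestronglyMeasurable
    · rw [Real.norm_eq_abs, abs_abs]
      have x1 : entropyProc P X Y B (n + 2) ω ∈ Set.Icc (0 : ℝ) 1 := b1 _ _
      have x2 : bsiEntropyProc P X Y S B n ω ∈ Set.Icc (0 : ℝ) 1 := b2 _ _
      exact abs_le.2 ⟨by linarith [x1.1, x2.2], by linarith [x1.2, x2.1]⟩
    · filter_upwards [hH, hHh] with ω w1 w2
      have := ((tendsto_add_atTop_iff_nat 2).2 w1).sub w2
      rw [sub_self] at this
      simpa using this.abs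
  -- One grandchild in four has a guaranteed gain; averaging over `2 ^ (n + 2)` indices costs the
  -- factor `4`.
  have hle : ∀ᶠ n in atTop, c * ((∑ i, φ (bsiIndexEntropy P X Y S n i)) / 2 ^ n) ≤
      4 * ((∑ k, D n k) / 2 ^ (n + 2)) := by
    filter_upwards [eventually_ge_atTop n₀] with n hn
    have hD0 : ∀ k, 0 ≤ D n k := fun k => abs_nonneg _
    have hs : c * ∑ i, φ (bsiIndexEntropy P X Y S n i) ≤ ∑ k, D n k := by
      rw [sum_child, sum_child, Finset.mul_sum]
      refine Finset.sum_le_sum fun i _ => ?_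
      have h1 := hgain n hn i
      have h2 : D n (child (child i 0) 0) = |indexEntropy P X Y (n + 2) (child (child i 0) 0) -
          bsiIndexEntropy P X Y S n i| := by simp only [D, parent_child]
      have h3 := le_abs_self (indexEntropy P X Y (n + 2) (child (child i 0) 0) -
          bsiIndexEntropy P X Y S n i)
      have h4 := hD0 (child (child i 0) 1)
      have h5 := hD0 (child (child i 1) 0)
      have h6 := hD0 (child (child i 1) 1)
      change c * ((1 - bsiIndexEntropy P X Y S n i) * bsiIndexEntropy P X Y S n i ^ 2) ≤ _
      linarith
    have e : 4 * ((∑ k, D n k) / 2 ^ (n + 2)) = (∑ k, D n k) / 2 ^ n := by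
      generalize ∑ k, D n k = x
      rw [pow_add]; ring
    rw [e, ← mul_div_assoc]
    exact div_le_div_of_nonneg_right hs (by positivity)
  have hlim := le_of_tendsto_of_tendsto (t1.const_mul c) (t2.const_mul 4) hle
  rw [mul_zero] at hlim
  have hI0 : ∫ ω, φ (g ω) ∂μ ≤ 0 := by
    by_contra! hpos
    exact absurd hlim (not_le.2 (mul_pos hc hpos))
  have hmem : ∀ᵐ ω ∂μ, g ω ∈ Set.Icc (0 : ℝ) 1 := by
    filter_upwards [hHh] with ω hω
    exact isClosed_Icc.mem_of_tendsto hω (Eventually.of_forall fun n => b2 n _)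
  have hgm : AEStronglyMeasurable g μ := aestronglyMeasurable_of_tendsto_ae atTop
    (fun n => (hB.integrable_comp n (bsiIndexEntropy P X Y S n)).aestronglyMeasurable) hHh
  have hφint : Integrable (fun ω => φ (g ω)) μ := by
    refine Integrable.of_bound (hφc.comp_aestronglyMeasurable hgm) 1 ?_
    filter_upwards [hmem] with ω hω
    rw [Real.norm_eq_abs, abs_of_nonneg (hφ0 _ hω)]
    exact hφ1 _ hω
  have hφnn : 0 ≤ᵐ[μ] fun ω => φ (g ω) := by
    filter_upwards [hmem] with ω hω using hφ0 _ hω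
  have hz := (integral_eq_zero_iff_of_nonneg_ae hφnn hφint).1
    (le_antisymm hI0 (integral_nonneg_of_ae hφnn))
  filter_upwards [hz] with ω hω
  rcases mul_eq_zero.1 (show (1 - g ω) * g ω ^ 2 = 0 from hω) with h1 | h1
  · right; linarith
  · left; exact pow_eq_zero_iff (two_ne_zero) |>.1 h1

/-- The entropy processes polarize to a common limit. -/
theorem IsFAIM.exists_polarizesTo (h : IsFAIM P X Y S) (hB : IsFairBits μ B) :
    ∃ L : Ω' → ℝ, PolarizesTo μ (entropyProc P X Y B) L ∧
      PolarizesTo μ (bsiEntropyProc P X Y S B) L := by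
  classical
  have hsub := h.submartingale_bsi hB
  have hbdd : ∀ n, eLpNorm (bsiEntropyProc P X Y S B n) 1 μ ≤ (1 : NNReal) := by
    intro n
    refine (eLpNorm_le_of_ae_bound (C := 1) (Eventually.of_forall fun ω => ?_)).trans (by simp)
    have x : bsiEntropyProc P X Y S B n ω ∈ Set.Icc (0 : ℝ) 1 := h.bsiIndexEntropy_mem_Icc n _
    exact abs_le.2 ⟨by linarith [x.1], x.2⟩
  obtain ⟨g, hgm, hlim⟩ := measurable_limit_of_tendsto_metrizable_ae
    (fun n => (hB.stronglyMeasurable_bsi n).measurable.aemeasurable)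
    (hsub.exists_ae_tendsto_of_bdd hbdd)
  have hH : ∀ᵐ ω ∂μ, Tendsto (fun n => entropyProc P X Y B n ω) atTop (𝓝 (g ω)) := by
    filter_upwards [hlim, h.ae_tendsto_sub hB] with ω w1 w2
    simpa using w2.add w1
  have h01 := h.ae_zero_or_one hB hH hlim
  -- `g` is `{0,1}`-valued only almost everywhere, while `PolarizesTo` asks for this everywhere; `L`
  -- differs from it on a null set.
  let L : Ω' → ℝ := fun ω => if g ω = 1 then 1 else 0
  have hL : ∀ᵐ ω ∂μ, L ω = g ω := by
    filter_upwards [h01] with ω hω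
    rcases hω with hω | hω <;> simp [L, hω]
  have hLm : Measurable L :=
    Measurable.ite (hgm (measurableSet_singleton 1)) measurable_const measurable_const
  have hL01 : ∀ ω, L ω = 0 ∨ L ω = 1 := fun ω => by
    simp only [L]; split_ifs <;> simp
  refine ⟨L, ⟨fun n => (measurable_of_countable (indexEntropy P X Y n)).comp
    (hB.measurable_bitIndex n), fun n ω => h.indexEntropy_mem_Icc n _, hLm, hL01, ?_⟩,
    ⟨fun n => (hB.stronglyMeasurable_bsi n).measurable,
      fun n ω => h.bsiIndexEntropy_mem_Icc n _, hLm, hL01, ?_⟩⟩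
  · filter_upwards [hH, hL] with ω w1 w2
    rwa [w2]
  · filter_upwards [hlim, hL] with ω w1 w2
    rwa [w2]

/-! ### The mean of the limit and the counts of indices -/

omit [IsProbabilityMeasure μ] in
theorem PolarizesTo.integral_eq {A : ℕ → Ω' → ℝ} {L : Ω' → ℝ} (h : PolarizesTo μ A L) :
    ∫ ω, L ω ∂μ = μ.real {ω | L ω = 1} := by
  have : L = Set.indicator {ω | L ω = 1} 1 := by
    funext ω
    rcases h.lim_eq ω with hω | hω <;> simp [hω]
  conv_lhs => rw [this]
  exact integral_indicator_one (h.measurable_lim (measurableSet_singleton 1))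

/-- The averages of the index entropies tend to the mean of `L` by bounded convergence, and to the
entropy rate along the block lengths `2 ^ n`. -/
theorem IsFAIM.integral_lim (h : IsFAIM P X Y S) (hB : IsFairBits μ B) {L : Ω' → ℝ}
    (hL : PolarizesTo μ (entropyProc P X Y B) L) : ∫ ω, L ω ∂μ = condEntropyRate P X Y := by
  have t1 := hB.tendsto_average (F := fun n i => indexEntropy P X Y n i) (fun n i => by
    have := h.indexEntropy_mem_Icc n i
    exact abs_le.2 ⟨by linarith [this.1], this.2⟩) hL.tendsto
  have t2 := h.tendsto_condEntropyRate.comp (tendsto_pow_atTop_atTop_of_one_lt one_lt_two)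
  refine tendsto_nhds_unique t1 (t2.congr fun n => ?_)
  simp only [Function.comp_apply]
  rw [h.sum_indexEntropy]
  push_cast
  rfl

theorem card_div_eq_sum {n : ℕ} (p : Fin (2 ^ n) → Prop) [DecidablePred p] :
    (Nat.card {i // p i} : ℝ) / 2 ^ n = (∑ i, if p i then (1 : ℝ) else 0) / 2 ^ n := by
  rw [Nat.card_eq_fintype_card, Fintype.card_subtype, Finset.sum_boole]

omit [IsProbabilityMeasure P] in
-- The limit is `0` or `1`, away from the threshold `1 - ε`, so the indicators converge to `L`
-- almost surely and their averages to its mean.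
theorem IsFairBits.tendsto_card_high (hB : IsFairBits μ B) {L : Ω' → ℝ}
    (hL : PolarizesTo μ (bsiEntropyProc P X Y S B) L) {ε : ℝ} (h0 : 0 < ε) (h1 : ε < 1) :
    Tendsto (fun n : ℕ =>
      (Nat.card {i : Fin (2 ^ n) // bsiIndexEntropy P X Y S n i > 1 - ε} : ℝ) / 2 ^ n) atTop
      (𝓝 (∫ ω, L ω ∂μ)) := by
  classical
  simp_rw [card_div_eq_sum]
  refine hB.tendsto_average
    (F := fun n i => if bsiIndexEntropy P X Y S n i > 1 - ε then 1 else 0) (fun n i => ?_) ?_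
  · split_ifs <;> simp
  · filter_upwards [hL.tendsto] with ω hω
    rcases hL.lim_eq ω with hl | hl
    · rw [hl] at hω ⊢
      refine tendsto_const_nhds.congr' ?_
      filter_upwards [hω.eventually (gt_mem_nhds (show 0 < 1 - ε by linarith))] with n hn
      exact (if_neg (not_lt.2 (le_of_lt hn))).symm
    · rw [hl] at hω ⊢
      refine tendsto_const_nhds.congr' ?_
      filter_upwards [hω.eventually (lt_mem_nhds (show 1 - ε < 1 by linarith))] with n hn
      exact (if_pos hn).symm

omit [IsProbabilityMeasure P] in
theorem IsFairBits.tendsto_card_low (hB : IsFairBits μ B) {L : Ω' → ℝ}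
    (hL : PolarizesTo μ (bsiEntropyProc P X Y S B) L) {ε : ℝ} (h0 : 0 < ε) (h1 : ε < 1) :
    Tendsto (fun n : ℕ =>
      (Nat.card {i : Fin (2 ^ n) // bsiIndexEntropy P X Y S n i < ε} : ℝ) / 2 ^ n) atTop
      (𝓝 (∫ ω, (1 - L ω) ∂μ)) := by
  classical
  simp_rw [card_div_eq_sum]
  refine hB.tendsto_average
    (F := fun n i => if bsiIndexEntropy P X Y S n i < ε then 1 else 0) (fun n i => ?_) ?_
  · split_ifs <;> simp
  · filter_upwards [hL.tendsto] with ω hω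
    rcases hL.lim_eq ω with hl | hl
    · rw [hl] at hω ⊢
      rw [sub_zero]
      refine tendsto_const_nhds.congr' ?_
      filter_upwards [hω.eventually (gt_mem_nhds h0)] with n hn
      exact (if_pos hn).symm
    · rw [hl] at hω ⊢
      rw [sub_self]
      refine tendsto_const_nhds.congr' ?_
      filter_upwards [hω.eventually (lt_mem_nhds h1)] with n hn
      exact (if_neg (not_lt.2 (le_of_lt hn))).symm

theorem PolarizesTo.integrable_lim {A : ℕ → Ω' → ℝ} {L : Ω' → ℝ} (h : PolarizesTo μ A L) :
    Integrable L μ :=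
  Integrable.of_bound h.measurable_lim.aestronglyMeasurable 1
    (Eventually.of_forall fun ω => by rcases h.lim_eq ω with hω | hω <;> simp [hω])

end Polarization

end FAIM

end

theorem mainTheorem3 {Ω Ω' 𝒴 𝒮 : Type*} [MeasurableSpace Ω] [MeasurableSpace Ω']
    [Fintype 𝒴] [Fintype 𝒮]
    (P : Measure Ω) [IsProbabilityMeasure P]
    (X : ℤ → Ω → ZMod 2) (Y : ℤ → Ω → 𝒴) (S : ℤ → Ω → 𝒮) (hFAIM : FAIM.IsFAIM P X Y S)
    (μ : Measure Ω') [IsProbabilityMeasure μ]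
    (B : ℕ → Ω' → Fin 2) (hB : FAIM.IsFairBits μ B) :
    -- the limit defining `H⋆(X|Y)` exists
    Tendsto (fun N : ℕ => FAIM.condEntropy P (FAIM.block X N) (FAIM.block Y N) / (N : ℝ))
      atTop (𝓝 (FAIM.condEntropyRate P X Y)) ∧
    -- `Ĥ_n` is a bounded submartingale, for `σ(B_1, …, B_n)` and for its natural filtration
    (∀ n ω, FAIM.bsiEntropyProc P X Y S B n ω ∈ Set.Icc (0 : ℝ) 1) ∧
    Submartingale (FAIM.bsiEntropyProc P X Y S B) (FAIM.bitFiltration B hB.measurable) μ ∧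
    (∃ hm : ∀ n, StronglyMeasurable (FAIM.bsiEntropyProc P X Y S B n),
      Submartingale (FAIM.bsiEntropyProc P X Y S B)
        (Filtration.natural (FAIM.bsiEntropyProc P X Y S B) hm) μ) ∧
    -- `H_n` and `Ĥ_n` polarize, to almost surely equal limits
    (∃ Hinf Hhatinf : Ω' → ℝ,
      FAIM.PolarizesTo μ (FAIM.entropyProc P X Y B) Hinf ∧
      FAIM.PolarizesTo μ (FAIM.bsiEntropyProc P X Y S B) Hhatinf ∧
      (∀ᵐ ω ∂μ, Hhatinf ω = Hinf ω) ∧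
      μ.real {ω | Hinf ω = 1} = FAIM.condEntropyRate P X Y) ∧
    -- the fractions of high-entropy and of low-entropy indices
    (∀ ε : ℝ, 0 < ε → ε < 1 →
      Tendsto (fun n : ℕ =>
          (Nat.card {i : Fin (2 ^ n) // FAIM.bsiIndexEntropy P X Y S n i > 1 - ε} : ℝ) / 2 ^ n)
        atTop (𝓝 (FAIM.condEntropyRate P X Y)) ∧
      Tendsto (fun n : ℕ =>
          (Nat.card {i : Fin (2 ^ n) // FAIM.bsiIndexEntropy P X Y S n i < ε} : ℝ) / 2 ^ n)
        atTop (𝓝 (1 - FAIM.condEntropyRate P X Y))) := by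
  obtain ⟨L, hL, hLh⟩ := hFAIM.exists_polarizesTo hB
  have hint := hFAIM.integral_lim hB hL
  refine ⟨hFAIM.tendsto_condEntropyRate, fun n ω => hFAIM.bsiIndexEntropy_mem_Icc n _,
    hFAIM.submartingale_bsi hB, ⟨hB.stronglyMeasurable_bsi,
      FAIM.submartingale_natural (hFAIM.submartingale_bsi hB) _⟩,
    ⟨L, L, hL, hLh, Filter.Eventually.of_forall fun _ => rfl, hL.integral_eq.symm.trans hint⟩,
    fun ε h0 h1 => ⟨hint ▸ hB.tendsto_card_high hLh h0 h1, ?_⟩⟩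
  have := hB.tendsto_card_low hLh h0 h1
  rwa [MeasureTheory.integral_sub (MeasureTheory.integrable_const 1) hL.integrable_lim, hint,
    MeasureTheory.integral_const, MeasureTheory.probReal_univ, one_smul] at this
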